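/- Let $\Omega\subset\mathbb{R}^2$ be a bounded regular open set (for instance a bounded Yin set) whose boundary is a finite union of Jordan curves $\gamma_1,\dots,\gamma_r$ with $\Omega$ on their left, each piecewise $C^1$ up to the end points of its pieces with nonvanishing derivative (for instance piecewise cubic); kinks are allowed. Let $a,b,c$ be real with $b^2-4ac<0$, $\mathcal{L}u=au_{xx}+bu_{xy}+cu_{yy}$, $\mathcal{N}$ a Dirichlet, Neumann or Robin boundary operator, $\epsilon\in(0,1)$, $h>0$. *Cut cells.* Cut $\Omega$ by the grid cells $\mathbf{C}_{\mathbf i}=(\mathbf{i}h,(\mathbf{i}+\mathbf{1})h)$, $\mathbf i\in\mathbb{Z}^2$, and merge: while some $\mathbf{C}_{\mathbf i}\cap\Omega$ has several connected components, all but one of maximal volume are merged (regularized union) into components of the four neighboring cut cells with touching closure, the target being one for which the merged volume is closest to $h^2$; then cut cells of volume $<\epsilon h^2$ are merged into neighbors by the same rule. Let $\mathcal{C}_{\mathbf i}$ be the resulting cut cells, each of at most one (tracked) component, and each of volume $\ge\epsilon h^2$ if nonempty. $\mathcal{C}_{\mathbf i}$ is *regular* if $\mathcal{C}_{\mathbf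 i}=\mathbf{C}_{\mathbf i}$. If a face of $\mathbf{C}_{\mathbf i}$ lies in $\partial\Omega$ and $\mathcal{C}_{\mathbf i}$ and the next three cells in the direction away from that face are regular, the two positions beyond the face are *ghost cells*. A nonempty $\mathcal{C}_{\mathbf i}$ is an *SFV cell* if all cells of its stencil $\{\mathbf i+m\mathbf e^d: |m|\le2,\ d=1,2\}$ (if $b=0$), or $\{\mathbf i+m_1\mathbf e^1+m_2\mathbf e^2:|m_1|,|m_2|\le2\}$ (if $b\neq0$), are regular or ghost cells; otherwise it is a *PLG cell*. *The block $A_{22}$.* For each PLG cell $\mathbf i$ choose a set $T(\mathbf i)$ of $15$ indices of nonempty cut cells, contained in some box of $R\times R$ cells that contains $\mathbf i$ ($R$ fixed, e.g. $R=5$), on which Lagrange interpolation by bivariate polynomials of total degree $\le4$ is uniquely solvable. The average of $\mathcal{L}u$ over $\mathcal{C}_{\mathbf i}$ is approximated by the linear combination of the cell averages of $u$ over $T(\mathbf i)$ and, if $\mathcal{C}_{\mathbf i}$ is not regular, the average of $\mathcal{N}u$ over $\partial\mathcal{C}_{\mathbf i}\cap\partial\Omega$, with coefficients $WM^{\top}(MWM^{\top})^{-1}\overline{\phi}$.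 Here $M$ holds these averages of the basis $((x-p)/h)^{\alpha}$, $|\alpha|\le4$ ($p$ the center of $\mathbf{C}_{\mathbf i}$), $\overline\phi$ holds the averages of $\mathcal{L}$ of the basis over $\mathcal{C}_{\mathbf i}$, and $W^{-1}$ is diagonal with entries $\max\{\|\mathbf j-\mathbf i\|_2,\tfrac12\}$ for $\mathbf j\in T(\mathbf i)$ and $\tfrac12$ for the boundary average. $A_{22}\in\mathbb{R}^{m\times m}$ consists of the coefficients of the averages over PLG cells in the rows of the PLG cells. Attach each PLG cell to a curve $\gamma_c$ carrying a point $\gamma_c(s)$, $s\in[0,1)$, of $\partial\Omega$ closest to the center of $\mathbf{C}_{\mathbf i}$; the cells attached to one curve are numbered consecutively by increasing $s$ (ties broken arbitrarily). *The factorization.* Call a square matrix of size $n$ *banded up to corners with width $p$* if its $(i,j)$ entry vanishes whenever $|i-j|>p$, except in the upper right and lower left $p\times p$ corners. With $k=\min(p,n)$, write it as $\begin{bmatrix}B&P\\Q&S\end{bmatrix}$, $S\in\mathbb{R}^{k\times k}$, and factor it by (a) banded Gaussian elimination without pivoting, $B=L_BU_B$; (b) solving $L_BX=P$ by forward substitutions;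 (c) solving $YU_B=Q$ by substitutions; (d) forming $S'=S-YX$ and its LU factorization $S'=L_SU_S$. The cost is the number of additions, subtractions, multiplications and divisions performed. **Theorem.** 1. There is $C$, depending only on $\Omega$ and its boundary curves, such that $m\le C\,h^{-1}$ for all $h\in(0,1]$, all $\epsilon,\mathcal{L},\mathcal{N}$ and every output of the merging. 2. Suppose moreover that the curves $\gamma_c$ are pairwise disjoint and have no cusps (incoming and outgoing tangent directions are nowhere opposite). Then for every $R$ there are $C$, $p$ and $h_0>0$, depending only on $\Omega$, its boundary curves and $R$, such that for all $h\in(0,h_0]$ and all choices above: $m\le C\,h^{-1}$; $A_{22}$ is block diagonal with one block per boundary curve, and each block is banded up to corners with width $p$; the factorization (a)–(d) of all these blocks (for a single boundary curve, of $A_{22}$ itself) costs at most $C\,h^{-1}$ operations; and, if in each block all leading principal minors of order less than the size of the block are nonzero, it yields a unit lower triangular and an upper triangular factor of each block, and the block diagonal matrices $L_{22}$, $U_{22}$ of these factors satisfy $A_{22}=L_{22}U_{22}$. -/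

import Mathlib

open MeasureTheory Filter Topology Set

noncomputable section

/-! ## The domain and its boundary curves -/

/-- The Euclidean plane. -/
abbrev Plane := EuclideanSpace ℝ (Fin 2)

/-- A piecewise continuously differentiable Jordan curve, parametrized by the interval from 0
to 1. Every piece is continuously differentiable up to its end points with nowhere vanishing
derivative; different pieces may meet at a kink. Closed cubic splines are a special case. -/
structure JordanCurve where
  toFun : ℝ → Plane
  pieces : ℕ
  knot : Fin (pieces + 1) → ℝ
  piece : Fin pieces → ℝ → Plane
  knot_strictMono : StrictMono knot
  knot_zero : knot 0 = 0
  knot_last : knot (Fin.last pieces) = 1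
  piece_contDiff : ∀ k, ContDiff ℝ 1 (piece k)
  piece_regular : ∀ k, ∀ t ∈ Icc (knot k.castSucc) (knot k.succ), deriv (piece k) t ≠ 0
  eq_piece : ∀ k, ∀ t ∈ Icc (knot k.castSucc) (knot k.succ), toFun t = piece k t
  closed : toFun 0 = toFun 1
  injOn : InjOn toFun (Ico 0 1)

namespace JordanCurve

/-- The set of points of the curve. -/
def trace (γ : JordanCurve) : Set Plane := γ.toFun '' Icc 0 1

/-- The curve has no cusp: the incoming and the outgoing tangent direction at a point of the
curve are never opposite to each other (kinks are allowed). -/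
def NoCusp (γ : JordanCurve) : Prop :=
  (∀ t ∈ Ioo (0 : ℝ) 1,
    ¬ SameRay ℝ (derivWithin γ.toFun (Iic t) t) (-derivWithin γ.toFun (Ici t) t)) ∧
  ¬ SameRay ℝ (derivWithin γ.toFun (Iic 1) 1) (-derivWithin γ.toFun (Ici 0) 0)

/-- The unit normal on the right of the direction of travel (defined off the kinks). -/
def normal (γ : JordanCurve) (t : ℝ) : Plane :=
  ‖deriv γ.toFun t‖⁻¹ • !₂[deriv γ.toFun t 1, -(deriv γ.toFun t 0)]

end JordanCurve

/-- `Ω` is a bounded regular open set, its boundary is the union of the Jordan curves `γ c`, and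
the curves are oriented so that `Ω` lies on their left; hence `(γ c).normal` is the outward unit
normal of `Ω`. -/
structure IsDomainWithBoundary {r : ℕ} (Ω : Set Plane) (γ : Fin r → JordanCurve) : Prop where
  bounded : Bornology.IsBounded Ω
  regularOpen : interior (closure Ω) = Ω
  frontier_eq : frontier Ω = ⋃ c, (γ c).trace
  left_side : ∀ c, ∀ᵐ t : ℝ, t ∈ Ioo (0 : ℝ) 1 →
    ∀ᶠ δ : ℝ in 𝓝[>] 0, (γ c).toFun t - δ • (γ c).normal t ∈ Ω

/-! ## Grid, cut cells and cell merging -/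

/-- Multi-indices of the Cartesian grid. -/
abbrev Idx := Fin 2 → ℤ

/-- The unit multi-index along dimension `d`. -/
def unitIdx (d : Fin 2) : Idx := Pi.single d 1

/-- The open square control volume of index `i` on the grid of size `h`. -/
def gridCell (h : ℝ) (i : Idx) : Set Plane :=
  {x | ∀ d, (i d : ℝ) * h < x d ∧ x d < ((i d : ℝ) + 1) * h}

/-- The center of a control volume. -/
def cellCenter (h : ℝ) (i : Idx) : Plane := WithLp.toLp 2 fun d => ((i d : ℝ) + 1 / 2) * h

/-- The lower face of the control volume `i` along dimension `d`, without its end points. -/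
def lowerFace (h : ℝ) (i : Idx) (d : Fin 2) : Set Plane :=
  {x | x d = (i d : ℝ) * h ∧ ∀ e ≠ d, (i e : ℝ) * h < x e ∧ x e < ((i e : ℝ) + 1) * h}

/-- The higher face of the control volume `i` along dimension `d`, without its end points. -/
def higherFace (h : ℝ) (i : Idx) (d : Fin 2) : Set Plane := lowerFace h (i + unitIdx d) d

/-- The exterior of a set: the interior of its complement. -/
def exteriorSet (S : Set Plane) : Set Plane := interior Sᶜ

/-- The regularized union of two sets: the exterior of the exterior of their union. -/
def regUnion (S T : Set Plane) : Set Plane := exteriorSet (exteriorSet (S ∪ T))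

/-- A state of the merging algorithm: for every index the set of the current components of the
cut cell with that index. A cut cell without components is empty. -/
abbrev CutState := Idx → Set (Set Plane)

/-- The initial state: the connected components of the intersections of `Ω` with the cells. -/
def initialState (Ω : Set Plane) (h : ℝ) : CutState := fun i =>
  {K | ∃ x ∈ gridCell h i ∩ Ω, K = connectedComponentIn (gridCell h i ∩ Ω) x}

/-- The components, in the four neighboring cells, whose closure meets the closure of the
component `K` of the cut cell `i`. -/
def neighborComponents (σ : CutState) (i : Idx) (K : Set Plane) : Set (Idx × Set Plane) :=
  {q | q.2 ∈ σ q.1 ∧ ∑ d, |q.1 d - i d| = 1 ∧ (closure K ∩ closure q.2).Nonempty}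

/-- `q` is a neighboring component for which the volume after merging is closest to `h ^ 2`. -/
def IsBestTarget (h : ℝ) (σ : CutState) (i : Idx) (K : Set Plane) (q : Idx × Set Plane) : Prop :=
  q ∈ neighborComponents σ i K ∧ ∀ q' ∈ neighborComponents σ i K,
    |volume.real q.2 + volume.real K - h ^ 2| ≤ |volume.real q'.2 + volume.real K - h ^ 2|

open Classical in
/-- Remove the component `K` from the cut cell `i` and merge it into the component `q.2` of the
cut cell `q.1`. -/
def mergeInto (σ : CutState) (i : Idx) (K : Set Plane) (q : Idx × Set Plane) : CutState :=
  fun j =>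
    if j = q.1 then insert (regUnion q.2 K) (σ j \ {q.2})
    else if j = i then σ j \ {K} else σ j

/-- One step of the merging algorithm. As long as some cut cell has several components, a
component of such a cell other than one of maximal volume is merged into a neighboring component.
When every cut cell has at most one component, cut cells of volume less than `ε h ^ 2` are merged
into a neighboring cell. The order of the steps and the choice between equally good targets are
left open. -/
inductive MergeStep (h ε : ℝ) : CutState → CutState → Prop
  | split (σ : CutState) (i : Idx) (K M : Set Plane) (q : Idx × Set Plane)
      (hK : K ∈ σ i) (hM : M ∈ σ i) (hKM : K ≠ M)
      (hmax : ∀ K' ∈ σ i, volume.real K' ≤ volume.real M)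
      (hq : IsBestTarget h σ i K q) : MergeStep h ε σ (mergeInto σ i K q)
  | small (σ : CutState) (i : Idx) (K : Set Plane) (q : Idx × Set Plane)
      (hσ : ∀ j, (σ j).Subsingleton) (hK : K ∈ σ i) (hsmall : volume.real K < ε * h ^ 2)
      (hq : IsBestTarget h σ i K q) : MergeStep h ε σ (mergeInto σ i K q)

/-- `𝒞` is an output of the merging algorithm: every cut cell has at most one component, and its
volume is at least `ε h ^ 2`. Empty cut cells are represented by the empty set. -/
def IsMergedCutCells (Ω : Set Plane) (h ε : ℝ) (𝒞 : Idx → Set Plane) : Prop :=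
  ∃ σ : CutState, Relation.ReflTransGen (MergeStep h ε) (initialState Ω h) σ ∧
    (∀ i, (σ i).Subsingleton) ∧ (∀ i, ∀ K ∈ σ i, ε * h ^ 2 ≤ volume.real K) ∧
    ∀ i, 𝒞 i = ⋃₀ σ i

/-! ## SFV cells and PLG cells -/

/-- The boundary condition, with its constants in the Robin case. -/
inductive BoundaryCondition
  | dirichlet
  | neumann
  | robin (α₁ α₂ : ℝ)

/-- A constant-coefficient elliptic operator `a u_xx + b u_xy + c u_yy` with a boundary
condition. -/
structure EllipticProblem where
  a : ℝ
  b : ℝ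
  c : ℝ
  elliptic : b ^ 2 - 4 * a * c < 0
  bc : BoundaryCondition

/-- A regular cell is a cut cell that fills its control volume. -/
def IsRegularCell (h : ℝ) (𝒞 : Idx → Set Plane) (i : Idx) : Prop := 𝒞 i = gridCell h i

/-- The cell `i` is extendable in the high direction along dimension `d`. -/
def ExtendableHigh (Ω : Set Plane) (h : ℝ) (𝒞 : Idx → Set Plane) (i : Idx) (d : Fin 2) : Prop :=
  higherFace h i d ⊆ frontier Ω ∧
    ∀ k : Fin 4, IsRegularCell h 𝒞 (i - ((k : ℕ) : ℤ) • unitIdx d)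

/-- The cell `i` is extendable in the low direction along dimension `d`. -/
def ExtendableLow (Ω : Set Plane) (h : ℝ) (𝒞 : Idx → Set Plane) (i : Idx) (d : Fin 2) : Prop :=
  lowerFace h i d ⊆ frontier Ω ∧
    ∀ k : Fin 4, IsRegularCell h 𝒞 (i + ((k : ℕ) : ℤ) • unitIdx d)

/-- Ghost cells: two of them are appended to every extendable face of an extendable cell. -/
def IsGhostCell (Ω : Set Plane) (h : ℝ) (𝒞 : Idx → Set Plane) (j : Idx) : Prop :=
  ∃ i d,
    (ExtendableHigh Ω h 𝒞 i d ∧ (j = i + unitIdx d ∨ j = i + (2 : ℤ) • unitIdx d)) ∨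
    (ExtendableLow Ω h 𝒞 i d ∧ (j = i - unitIdx d ∨ j = i - (2 : ℤ) • unitIdx d))

/-- The symmetric finite-volume stencil: a cross if `b = 0`, a 5-by-5 box otherwise. -/
def symmetricStencil (b : ℝ) (i : Idx) : Set Idx :=
  {j | (b = 0 ∧ ∃ d, ∃ m : ℤ, |m| ≤ 2 ∧ j = i + m • unitIdx d) ∨
    (b ≠ 0 ∧ ∃ m₁ m₂ : ℤ, |m₁| ≤ 2 ∧ |m₂| ≤ 2 ∧ j = i + m₁ • unitIdx 0 + m₂ • unitIdx 1)}

/-- The indices of the PLG cells: the nonempty cut cells whose symmetric stencil contains a cell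
that is neither regular nor a ghost cell. All other nonempty cut cells are SFV cells. -/
def plgCells (Ω : Set Plane) (E : EllipticProblem) (h : ℝ) (𝒞 : Idx → Set Plane) : Set Idx :=
  {i | (𝒞 i).Nonempty ∧
    ¬ ∀ j ∈ symmetricStencil E.b i, IsRegularCell h 𝒞 j ∨ IsGhostCell Ω h 𝒞 j}

/-! ## The discretization on PLG cells -/

/-- A finite set of nodes is poised for bivariate polynomials of total degree at most 4: Lagrange
interpolation on it is uniquely solvable. -/
def IsPoised (T : Finset Idx) : Prop :=
  ∀ f : Idx → ℝ, ∃! q : MvPolynomial (Fin 2) ℝ,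
    q.totalDegree ≤ 4 ∧ ∀ j ∈ T, MvPolynomial.eval (fun d => (j d : ℝ)) q = f j

/-- `T` is a poised lattice for the cell `i`: a poised set of 15 nonempty cut cells, chosen from
some box of `R` by `R` cells that contains `i`. -/
def IsPLGStencil (R : ℕ) (𝒞 : Idx → Set Plane) (i : Idx) (T : Finset Idx) : Prop :=
  (∃ o : Idx, (∀ d, o d ≤ i d ∧ i d < o d + R) ∧ ∀ j ∈ T, ∀ d, o d ≤ j d ∧ j d < o d + R) ∧
    (∀ j ∈ T, (𝒞 j).Nonempty) ∧ T.card = 15 ∧ IsPoised T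

/-- Partial derivative along dimension `d`. -/
def partialDeriv (d : Fin 2) (u : Plane → ℝ) (x : Plane) : ℝ :=
  fderiv ℝ u x (EuclideanSpace.single d 1)

/-- The elliptic operator applied to `u`. -/
def EllipticProblem.op (E : EllipticProblem) (u : Plane → ℝ) (x : Plane) : ℝ :=
  E.a * partialDeriv 0 (partialDeriv 0 u) x + E.b * partialDeriv 0 (partialDeriv 1 u) x +
    E.c * partialDeriv 1 (partialDeriv 1 u) x

/-- The boundary operator applied to `u` at a boundary point `x` with outward unit normal `n`. -/
def BoundaryCondition.op (N : BoundaryCondition) (u : Plane → ℝ) (x n : Plane) : ℝ :=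
  match N with
  | .dirichlet => u x
  | .neumann => fderiv ℝ u x n
  | .robin α₁ α₂ => α₁ * u x + α₂ * fderiv ℝ u x n

/-- Exponents of the monomials of total degree at most 4. -/
abbrev Expo := {α : Fin 2 → Fin 5 // (α 0 : ℕ) + (α 1 : ℕ) ≤ 4}

/-- The monomial basis, scaled by `h` and centered at the center of the cell `i`. -/
def basisFun (h : ℝ) (i : Idx) (α : Expo) (x : Plane) : ℝ :=
  ∏ d, ((x d - cellCenter h i d) / h) ^ (α.1 d : ℕ)

/-- The parameters of the points of `γ` on the cut boundary of `i`, which is the part of the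
boundary of `Ω` on the boundary of the cut cell. -/
def cutBoundaryParams (Ω : Set Plane) (γ : JordanCurve) (𝒞 : Idx → Set Plane) (i : Idx) : Set ℝ :=
  {t | t ∈ Ioo (0 : ℝ) 1 ∧ γ.toFun t ∈ frontier (𝒞 i) ∩ frontier Ω}

/-- The average of `N u` over the cut boundary of `i` with respect to arc length. -/
def boundaryAvg {r : ℕ} (Ω : Set Plane) (γ : Fin r → JordanCurve) (N : BoundaryCondition)
    (𝒞 : Idx → Set Plane) (i : Idx) (u : Plane → ℝ) : ℝ :=
  (∑ c, ∫ t in cutBoundaryParams Ω (γ c) 𝒞 i, ‖deriv (γ c).toFun t‖)⁻¹ *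
    ∑ c, ∫ t in cutBoundaryParams Ω (γ c) 𝒞 i,
      N.op u ((γ c).toFun t) ((γ c).normal t) * ‖deriv (γ c).toFun t‖

open Classical in
/-- The sample matrix of the cell `i` with stencil `T`: its columns are the cell averages of the
basis over the stencil cells and (index `none`) the boundary average. For a regular cell the last
column is dropped; this is expressed by a zero column, which gives the same coefficients. -/
def sampleMatrix {r : ℕ} (Ω : Set Plane) (γ : Fin r → JordanCurve) (E : EllipticProblem) (h : ℝ)
    (𝒞 : Idx → Set Plane) (i : Idx) (T : Finset Idx) : Matrix Expo (Option T) ℝ :=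
  fun α s => match s with
    | some j => ⨍ x in 𝒞 j, basisFun h i α x
    | none => if IsRegularCell h 𝒞 i then 0 else boundaryAvg Ω γ E.bc 𝒞 i (basisFun h i α)

/-- The diagonal weight matrix `W`; the weights of `W⁻¹` are the distances of the indices, bounded
below by `1 / 2`, and `1 / 2` for the boundary average. -/
def weightMatrix (i : Idx) (T : Finset Idx) : Matrix (Option T) (Option T) ℝ :=
  Matrix.diagonal fun s => match s with
    | some j => (max (Real.sqrt (∑ d, ((j.1 d : ℝ) - (i d : ℝ)) ^ 2)) (1 / 2))⁻¹
    | none => (1 / 2 : ℝ)⁻¹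

/-- The coefficients `W Mᵀ (M W Mᵀ)⁻¹ φ` of the approximation of the cell average of the elliptic
operator over the PLG cell `i`. -/
def plgCoeffs {r : ℕ} (Ω : Set Plane) (γ : Fin r → JordanCurve) (E : EllipticProblem) (h : ℝ)
    (𝒞 : Idx → Set Plane) (i : Idx) (T : Finset Idx) : Option T → ℝ :=
  let M := sampleMatrix Ω γ E h 𝒞 i T
  let W := weightMatrix i T
  (W * M.transpose * (M * W * M.transpose)⁻¹).mulVec
    fun α => ⨍ x in 𝒞 i, E.op (basisFun h i α) x

/-- The coefficient of the cell average over `j` in the equation of the PLG cell `i`. -/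
def plgEntry {r : ℕ} (Ω : Set Plane) (γ : Fin r → JordanCurve) (E : EllipticProblem) (h : ℝ)
    (𝒞 : Idx → Set Plane) (T : Idx → Finset Idx) (i j : Idx) : ℝ :=
  if hj : j ∈ T i then plgCoeffs Ω γ E h 𝒞 i (T i) (some ⟨j, hj⟩) else 0

/-! ## The ordering of the PLG cells and the matrix -/

/-- An ordering of the PLG cells. Every PLG cell is attached to a boundary curve that carries a
boundary point closest to the center of the cell. The cells attached to the same curve are
numbered consecutively in the order of the parameters of these closest points. -/
structure PLGOrdering {r : ℕ} (Ω : Set Plane) (γ : Fin r → JordanCurve) (E : EllipticProblem)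
    (h : ℝ) (𝒞 : Idx → Set Plane) where
  size : Fin r → ℕ
  cell : (Σ c, Fin (size c)) → Idx
  param : (c : Fin r) → Fin (size c) → ℝ
  cell_injective : Function.Injective cell
  range_cell : Set.range cell = plgCells Ω E h 𝒞
  param_mem : ∀ c k, param c k ∈ Ico (0 : ℝ) 1
  closest : ∀ c k, ∀ x ∈ frontier Ω,
    dist (cellCenter h (cell ⟨c, k⟩)) ((γ c).toFun (param c k)) ≤
      dist (cellCenter h (cell ⟨c, k⟩)) x
  param_monotone : ∀ c, Monotone (param c)

namespace PLGOrdering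

variable {r : ℕ} {Ω : Set Plane} {γ : Fin r → JordanCurve} {E : EllipticProblem}
  {h : ℝ} {𝒞 : Idx → Set Plane}

/-- The block of the discrete system whose rows and columns belong to the PLG cells. -/
def A22 (o : PLGOrdering Ω γ E h 𝒞) (T : Idx → Finset Idx) :
    Matrix (Σ c, Fin (o.size c)) (Σ c, Fin (o.size c)) ℝ :=
  fun x y => plgEntry Ω γ E h 𝒞 T (o.cell x) (o.cell y)

/-- The diagonal block of `A22` that belongs to the PLG cells near the curve `γ c`. -/
def A22Block (o : PLGOrdering Ω γ E h 𝒞) (T : Idx → Finset Idx) (c : Fin r) :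
    Matrix (Fin (o.size c)) (Fin (o.size c)) ℝ :=
  fun k l => o.A22 T ⟨c, k⟩ ⟨c, l⟩

end PLGOrdering

/-- Up to two square blocks of dimension at most `p` in its upper right and its lower left corner,
the matrix has bandwidth at most `p`. -/
def IsBandedUpToCorners {n : ℕ} (p : ℕ) (A : Matrix (Fin n) (Fin n) ℝ) : Prop :=
  ∀ i j : Fin n, A i j ≠ 0 →
    ((i : ℕ) ≤ j + p ∧ (j : ℕ) ≤ i + p) ∨
    ((i : ℕ) < p ∧ n ≤ (j : ℕ) + p) ∨ ((j : ℕ) < p ∧ n ≤ (i : ℕ) + p)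

/-! ## The LU factorization with operation count -/

/-- The result of a computation with the number of arithmetic operations it has performed. -/
structure Counted (α : Type) where
  val : α
  cost : ℕ

instance : Monad Counted where
  pure x := ⟨x, 0⟩
  bind x f := ⟨(f x.val).val, x.cost + (f x.val).cost⟩

/-- Subtraction, one operation. -/
def opSub (x y : ℝ) : Counted ℝ := ⟨x - y, 1⟩

/-- Multiplication, one operation. -/
def opMul (x y : ℝ) : Counted ℝ := ⟨x * y, 1⟩

/-- Division, one operation. -/
def opDiv (x y : ℝ) : Counted ℝ := ⟨x / y, 1⟩

/-- A two-dimensional array of real numbers. -/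
abbrev Arr := ℕ → ℕ → ℝ

/-- Overwrite the entry `(i, j)` by `v`. -/
def Arr.store (A : Arr) (i j : ℕ) (v : ℝ) : Arr :=
  fun i' j' => if i' = i ∧ j' = j then v else A i' j'

/-- Run `body i` for `i = lo, lo + 1, …, hi - 1`. -/
def forRange (lo hi : ℕ) (body : ℕ → Arr → Counted Arr) (A : Arr) : Counted Arr :=
  (List.range' lo (hi - lo)).foldlM (fun A i => body i A) A

/-- Replace the entry `(i, j)` by its difference with the product of entries `(i, s)` and
`(s, j)`. -/
def updateEntry (i s j : ℕ) (A : Arr) : Counted Arr := do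
  let t ← opMul (A i s) (A s j)
  let v ← opSub (A i j) t
  pure (A.store i j v)

/-- Replace the entry `(i, s)` by its quotient by the entry `(s, s)`. -/
def divideEntry (i s : ℕ) (A : Arr) : Counted Arr := do
  let l ← opDiv (A i s) (A s s)
  pure (A.store i s l)

/-- Gaussian elimination, in place and without pivoting, of the diagonal block with rows and
columns `lo, …, hi - 1`, which is assumed to have bandwidth at most `p`. The multipliers are
stored below the diagonal. -/
def bandedLU (p lo hi : ℕ) : Arr → Counted Arr :=
  forRange lo hi fun s =>
    forRange (s + 1) (min hi (s + p + 1)) fun i A => do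
      let A ← divideEntry i s A
      forRange (s + 1) (min hi (s + p + 1)) (fun j => updateEntry i s j) A

/-- Forward substitutions for `L_B X = P`: the unit lower triangular factor `L_B` (bandwidth at
most `p`) is stored in the first `b` rows and columns, and `P` in the columns `b, …, n - 1` of the
first `b` rows, where it is overwritten by `X`. -/
def solveX (p b n : ℕ) : Arr → Counted Arr :=
  forRange b n fun j => forRange 0 b fun i => forRange (i - p) i fun s => updateEntry i s j

/-- Substitutions for `Y U_B = Q`: the upper triangular factor `U_B` (bandwidth at most `p`) is
stored in the first `b` rows and columns, and `Q` in the first `b` columns of the rows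
`b, …, n - 1`, where it is overwritten by `Y`. -/
def solveY (p b n : ℕ) : Arr → Counted Arr :=
  forRange b n fun i => forRange 0 b fun j A => do
    let A ← forRange (j - p) j (fun s => updateEntry i s j) A
    divideEntry i j A

/-- Overwrite the lower right block `S` by `S - Y X`. -/
def formSchur (b n : ℕ) : Arr → Counted Arr :=
  forRange b n fun i => forRange b n fun j => forRange 0 b fun s => updateEntry i s j

/-- The LU factorization of a matrix `[B, P; Q, S]` of size `n` that is banded up to corner blocks
of dimension `p`, where `S` has dimension `k = min p n`: banded LU factorization of `B`, solution
of `L_B X = P` and of `Y U_B = Q`, and (unbanded) LU factorization of `S - Y X`. -/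
def cornerLU (p n : ℕ) (A : Arr) : Counted Arr := do
  let k := min p n
  let b := n - k
  let A ← bandedLU p 0 b A
  let A ← solveX p b n A
  let A ← solveY p b n A
  let A ← formSchur b n A
  bandedLU k b n A

/-- A matrix as an array. -/
def toArr {n : ℕ} (A : Matrix (Fin n) (Fin n) ℝ) : Arr :=
  fun i j => if hij : i < n ∧ j < n then A ⟨i, hij.1⟩ ⟨j, hij.2⟩ else 0

/-- The factorization applied to a matrix. -/
def runLU {n : ℕ} (p : ℕ) (A : Matrix (Fin n) (Fin n) ℝ) : Counted Arr := cornerLU p n (toArr A)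

/-- The unit lower triangular factor that is stored in an array. -/
def lowerFactor (n : ℕ) (A : Arr) : Matrix (Fin n) (Fin n) ℝ :=
  fun i j => if j < i then A i j else if i = j then 1 else 0

/-- The upper triangular factor that is stored in an array. -/
def upperFactor (n : ℕ) (A : Arr) : Matrix (Fin n) (Fin n) ℝ :=
  fun i j => if i ≤ j then A i j else 0

/-- All leading principal minors of order less than `n` are nonzero: no zero pivot is met when
the matrix is factored without pivoting. -/
def HasNonzeroPivots {n : ℕ} (A : Matrix (Fin n) (Fin n) ℝ) : Prop :=
  ∀ q : ℕ, ∀ hq : q < n, (A.submatrix (Fin.castLE hq.le) (Fin.castLE hq.le)).det ≠ 0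

end

/-! ## Loops with operation count -/

/-! The cell count rests on one geometric fact: merging alters cells only near the boundary. A
component is never removed from a cell contained in `Ω`, since such a cell has a single component of
volume at least `h ^ 2`. Hence a cell inside `Ω`, all of whose neighbors that meet `Ω` lie in `Ω`
too, is never touched, and every PLG cell has its center within `7 * h` of `frontier Ω`
(`exists_frontier_near_plgCell`). A Lipschitz curve is covered by `O(1/h)` balls of radius `O(h)`,
and each of these holds boundedly many cell centers, so there are `O(1/h)` PLG cells.

For the band structure, a nonzero entry of `A22` couples cells at most `R` apart in each index, so
their closest boundary points are `O(h)` apart. For small `h` these points lie on the same curve,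
because disjoint compact curves have positive distance. Without cusps a Jordan curve satisfies a
chord-arc inequality (`exists_chordArc`), so the parameters are `O(h)` apart on the circle. All
cells numbered between the two along the short arc then lie in a ball of radius `O(h)`, and there
are boundedly many of them. Short arcs through the starting point of the curve produce the corner
blocks.

For the factorization, `luEntry` defines the exact triangular factors by recursion, and each stage
of the algorithm is shown to write these numbers. The band loops lose nothing, since elimination
without pivoting creates no fill outside the band. The cost is bounded loop by loop, independently
of the data. -/

@[simp] theorem Counted.pure_cost {α : Type} (x : α) : (pure x : Counted α).cost = 0 := rfl

@[simp] theorem Counted.bind_val {α β : Type} (x : Counted α) (f : α → Counted β) :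
    (x >>= f).val = (f x.val).val := rfl

@[simp] theorem Counted.bind_cost {α β : Type} (x : Counted α) (f : α → Counted β) :
    (x >>= f).cost = x.cost + (f x.val).cost := rfl

theorem forRange_of_le {lo hi : ℕ} (h : hi ≤ lo) (body : ℕ → Arr → Counted Arr) (A : Arr) :
    forRange lo hi body A = pure A := by
  simp [forRange, Nat.sub_eq_zero_of_le h]

theorem forRange_of_lt {lo hi : ℕ} (h : lo < hi) (body : ℕ → Arr → Counted Arr) (A : Arr) :
    forRange lo hi body A = body lo A >>= forRange (lo + 1) hi body := by
  obtain ⟨d, rfl⟩ := Nat.exists_eq_add_of_lt h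
  have h1 : lo + d + 1 - lo = d + 1 := by omega
  have h2 : lo + d + 1 - (lo + 1) = d := by omega
  unfold forRange
  rw [h1, h2, List.range'_succ, List.foldlM_cons]

/-- The invariant rule for counted loops. -/
theorem forRange_val_induction {lo hi : ℕ} (hle : lo ≤ hi) {body : ℕ → Arr → Counted Arr}
    (P : ℕ → Arr → Prop) {A : Arr} (h0 : P lo A)
    (step : ∀ i, lo ≤ i → i < hi → ∀ B, P i B → P (i + 1) (body i B).val) :
    P hi (forRange lo hi body A).val := by
  obtain ⟨d, rfl⟩ := Nat.exists_eq_add_of_le hle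
  induction d generalizing lo A with
  | zero => rw [forRange_of_le (by omega)]; exact h0
  | succ d ih =>
    rw [forRange_of_lt (by omega), Counted.bind_val]
    have := ih (lo := lo + 1) (A := (body lo A).val) (step lo le_rfl (by omega) A h0) (by omega)
      (fun i h1 h2 B hB => step i (by omega) (by omega) B hB)
    rwa [show lo + 1 + d = lo + (d + 1) by omega] at this

/-- The bound on the body is required for every array, which is harmless because no loop branches on
matrix entries. The cost estimates therefore need no assumption on the pivots. -/
theorem forRange_cost_le {lo hi c : ℕ} {body : ℕ → Arr → Counted Arr}
    (h : ∀ i, lo ≤ i → i < hi → ∀ A, (body i A).cost ≤ c) (A : Arr) :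
    (forRange lo hi body A).cost ≤ (hi - lo) * c := by
  rcases le_total hi lo with hle | hle
  · simp [forRange_of_le hle]
  obtain ⟨d, rfl⟩ := Nat.exists_eq_add_of_le hle
  induction d generalizing lo A with
  | zero => simp [forRange_of_le]
  | succ d ih =>
    rw [forRange_of_lt (by omega), Counted.bind_cost]
    have h1 := ih (lo := lo + 1) (body lo A).val
      (fun i h1 h2 => h i (by omega) (by omega)) (by omega)
    rw [show lo + 1 + d = lo + (d + 1) by omega] at h1
    have h2 := h lo le_rfl (by omega) A
    have h3 : lo + (d + 1) - (lo + 1) = d := by omega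
    have h4 : lo + (d + 1) - lo = d + 1 := by omega
    rw [h3] at h1
    rw [h4, add_mul]
    omega

theorem updateEntry_cost (i s j : ℕ) (A : Arr) : (updateEntry i s j A).cost = 2 := rfl

theorem divideEntry_cost (i s : ℕ) (A : Arr) : (divideEntry i s A).cost = 1 := rfl

theorem updateEntry_val (i s j : ℕ) (A : Arr) :
    (updateEntry i s j A).val = A.store i j (A i j - A i s * A s j) := rfl

theorem divideEntry_val (i s : ℕ) (A : Arr) :
    (divideEntry i s A).val = A.store i s (A i s / A s s) := rfl

/-! ## The cost of the factorization -/

theorem bandedLU_cost_le (p lo hi : ℕ) (A : Arr) :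
    (bandedLU p lo hi A).cost ≤ (hi - lo) * (p * (1 + p * 2)) := by
  refine forRange_cost_le (fun s _ _ A => ?_) A
  refine (forRange_cost_le (c := 1 + p * 2) (fun i _ _ A => ?_) A).trans
    (Nat.mul_le_mul_right _ (by omega))
  rw [Counted.bind_cost, divideEntry_cost]
  refine Nat.add_le_add_left ?_ _
  exact (forRange_cost_le (c := 2) (fun j _ _ A => (updateEntry_cost i s j A).le) _).trans
    (Nat.mul_le_mul_right _ (by omega))

theorem solveX_cost_le (p b n : ℕ) (A : Arr) :
    (solveX p b n A).cost ≤ (n - b) * (b * (p * 2)) := by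
  refine forRange_cost_le (fun j _ _ A => ?_) A
  refine forRange_cost_le (fun i _ _ A => ?_) A
  exact (forRange_cost_le (c := 2) (fun s _ _ A => (updateEntry_cost i s j A).le) _).trans
    (Nat.mul_le_mul_right _ (by omega))

theorem solveY_cost_le (p b n : ℕ) (A : Arr) :
    (solveY p b n A).cost ≤ (n - b) * (b * (p * 2 + 1)) := by
  refine forRange_cost_le (fun i _ _ A => ?_) A
  refine forRange_cost_le (fun j _ _ A => ?_) A
  rw [Counted.bind_cost, divideEntry_cost]
  refine Nat.add_le_add_right ?_ _
  exact (forRange_cost_le (c := 2) (fun s _ _ A => (updateEntry_cost i s j A).le) _).trans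
    (Nat.mul_le_mul_right _ (by omega))

theorem formSchur_cost_le (b n : ℕ) (A : Arr) :
    (formSchur b n A).cost ≤ (n - b) * ((n - b) * (b * 2)) := by
  refine forRange_cost_le (fun i _ _ A => ?_) A
  refine forRange_cost_le (fun j _ _ A => ?_) A
  exact forRange_cost_le (c := 2) (fun s _ _ A => (updateEntry_cost i s j A).le) _

/-- For a fixed bandwidth the number of operations is linear in the size of the matrix. -/
theorem runLU_cost_le (p : ℕ) {n : ℕ} (A : Matrix (Fin n) (Fin n) ℝ) :
    (runLU p A).cost ≤ (10 * p ^ 2 + 3 * p) * n := by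
  have e1 := fun A => bandedLU_cost_le p 0 (n - min p n) A
  have e2 := fun A => solveX_cost_le p (n - min p n) n A
  have e3 := fun A => solveY_cost_le p (n - min p n) n A
  have e4 := fun A => formSchur_cost_le (n - min p n) n A
  have e5 := fun A => bandedLU_cost_le (min p n) (n - min p n) n A
  have hk : n - (n - min p n) = min p n := by omega
  have hkp : min p n ≤ p := min_le_left _ _
  have hkn : min p n ≤ n := min_le_right _ _
  simp only [runLU, cornerLU, Counted.bind_cost]
  rw [hk] at e2 e3 e4 e5
  generalize min p n = k at *
  have hb : n - k + k = n := by omega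
  generalize n - k = b at *
  have hbn : b ≤ n := by omega
  refine (add_le_add (e1 _) (add_le_add (e2 _) (add_le_add (e3 _) (add_le_add (e4 _)
    (e5 _))))).trans ?_
  -- Each term must keep exactly one factor `n`: `b ≤ n` supplies it in the first four, and in the
  -- last one factor `k` is bounded by `n` and the others by `p`. The sum of the five bounds is
  -- exactly the claimed one.
  have f1 : (b - 0) * (p * (1 + p * 2)) ≤ n * (p * (1 + p * 2)) := Nat.mul_le_mul_right _ (by omega)
  have f2 : k * (b * (p * 2)) ≤ p * (n * (p * 2)) := by gcongr
  have f3 : k * (b * (p * 2 + 1)) ≤ p * (n * (p * 2 + 1)) := by gcongr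
  have f4 : k * (k * (b * 2)) ≤ p * (p * (n * 2)) := by gcongr
  have f5 : k * (k * (1 + k * 2)) ≤ n * (p * (1 + p * 2)) := by gcongr
  nlinarith [f1, f2, f3, f4, f5]

/-! ## The entries of the factors -/

/-- The entries of the triangular factors of the array `A`, the multipliers stored below the
diagonal. -/
noncomputable def luEntry (A : Arr) (i j : ℕ) : ℝ :=
  (A i j - ∑ s : Fin (min i j), luEntry A i s * luEntry A s j) /
    if j < i then luEntry A j j else 1
termination_by i + j
decreasing_by all_goals omega

/-- The array `A` after the elimination of the first `q` columns. -/
noncomputable def schurEntry (A : Arr) (q i j : ℕ) : ℝ :=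
  A i j - ∑ s ∈ Finset.range q, luEntry A i s * luEntry A s j

theorem luEntry_eq (A : Arr) (i j : ℕ) :
    luEntry A i j = schurEntry A (min i j) i j / if j < i then luEntry A j j else 1 := by
  rw [luEntry, schurEntry, Finset.sum_range]

theorem luEntry_of_le (A : Arr) {i j : ℕ} (h : i ≤ j) : luEntry A i j = schurEntry A i i j := by
  rw [luEntry_eq, if_neg (by omega), min_eq_left h, div_one]

theorem luEntry_of_lt (A : Arr) {i j : ℕ} (h : j < i) :
    luEntry A i j = schurEntry A j i j / luEntry A j j := by
  rw [luEntry_eq, if_pos h, min_eq_right h.le]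

theorem schurEntry_zero (A : Arr) (i j : ℕ) : schurEntry A 0 i j = A i j := by
  simp [schurEntry]

theorem schurEntry_succ (A : Arr) (q i j : ℕ) :
    schurEntry A (q + 1) i j = schurEntry A q i j - luEntry A i q * luEntry A q j := by
  simp only [schurEntry, Finset.sum_range_succ]; ring

/-- There is no fill-in: for `(i, j)` outside the band and `s < min i j`, one of `(i, s)` and `(s,
j)` is even farther from the diagonal, so each product in the recursion vanishes by induction on
`min i j`. Only the leading block of size `b` is used, so corner entries do not interfere. -/
theorem luEntry_eq_zero_of_banded {A : Arr} {p b : ℕ}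
    (h : ∀ i j, i < b → j < b → (i + p < j ∨ j + p < i) → A i j = 0) :
    ∀ i j, i < b → j < b → (i + p < j ∨ j + p < i) → luEntry A i j = 0 := by
  suffices H : ∀ m i j, min i j = m → i < b → j < b → (i + p < j ∨ j + p < i) →
      luEntry A i j = 0 from fun i j => H _ i j rfl
  intro m
  induction m using Nat.strong_induction_on with
  | _ m ih =>
    intro i j hm hi hj hij
    rw [luEntry_eq, schurEntry, h i j hi hj hij, Finset.sum_eq_zero, sub_zero, zero_div]
    intro s hs
    rw [Finset.mem_range] at hs
    rcases hij with hij | hij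
    · rw [ih s (by omega) s j (by omega) (by omega) hj (by omega), mul_zero]
    · rw [ih s (by omega) i s (by omega) hi (by omega) (by omega), zero_mul]

/-- The factors of the leading block of size `q` reproduce this block. -/
theorem lowerFactor_mul_upperFactor {A : Arr} {q : ℕ}
    (hpiv : ∀ j, j + 1 < q → luEntry A j j ≠ 0) :
    lowerFactor q (luEntry A) * upperFactor q (luEntry A) =
      Matrix.of fun i j : Fin q => A i j := by
  ext i j
  simp only [Matrix.mul_apply, Matrix.of_apply, lowerFactor, upperFactor]
  rw [Finset.sum_fin_eq_sum_range]
  have key : ∀ s ∈ Finset.range q,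
      (if h : s < q then (if (⟨s, h⟩ : Fin q) < i then luEntry A i s else
        if i = ⟨s, h⟩ then 1 else 0) * (if (⟨s, h⟩ : Fin q) ≤ j then luEntry A s j else 0) else 0) =
      if s ≤ min (i : ℕ) j then (if s < i then luEntry A i s else 1) * luEntry A s j else 0 := by
    intro s hs
    rw [Finset.mem_range] at hs
    simp only [hs, dif_pos, Fin.lt_def, Fin.le_def, Fin.ext_iff, le_min_iff]
    by_cases h1 : s < i <;> by_cases h2 : s ≤ j <;> by_cases h3 : (i : ℕ) = s <;>
      simp [h1, h2, h3, le_of_lt]; omega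
  rw [Finset.sum_congr rfl key, ← Finset.sum_filter]
  have hf : (Finset.range q).filter (fun s => s ≤ min (i : ℕ) j) =
      Finset.range (min (i : ℕ) j + 1) := by
    ext s; simp only [Finset.mem_filter, Finset.mem_range]; omega
  rw [hf, Finset.sum_range_succ]
  have hs : ∑ s ∈ Finset.range (min (i : ℕ) j),
      (if s < (i : ℕ) then luEntry A i s else 1) * luEntry A s j =
      ∑ s ∈ Finset.range (min (i : ℕ) j), luEntry A i s * luEntry A s j := by
    refine Finset.sum_congr rfl fun s hs => ?_
    rw [Finset.mem_range] at hs
    rw [if_pos (by omega)]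
  rw [hs]
  -- Below the diagonal the pivot `j` must cancel. There `j < i < q`, so the last pivot is never
  -- divided by and may vanish.
  rcases lt_or_ge (j : ℕ) i with h | h
  · rw [min_eq_right h.le, if_pos h, luEntry_of_lt A h,
      div_mul_cancel₀ _ (hpiv j (by omega)), schurEntry]
    ring
  · rw [min_eq_left h, if_neg (by omega), luEntry_of_le A h, schurEntry]
    ring

theorem det_lowerFactor (n : ℕ) (A : Arr) : (lowerFactor n A).det = 1 := by
  rw [Matrix.det_of_isLowerTriangular]
  · simp [lowerFactor]
  · intro i j hij
    have : i < j := hij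
    simp [lowerFactor, not_lt.2 this.le, this.ne]

theorem det_upperFactor (n : ℕ) (A : Arr) : (upperFactor n A).det = ∏ i : Fin n, A i i := by
  rw [Matrix.det_of_isUpperTriangular]
  · simp [upperFactor]
  · intro i j hij
    have : j < i := hij
    simp [upperFactor, this]

theorem toArr_apply {n : ℕ} (A : Matrix (Fin n) (Fin n) ℝ) (i j : Fin n) : toArr A i j = A i j := by
  simp [toArr]

/-- The leading minor of order `j + 1` is the product of the pivots `0, …, j`. This uses only that
the pivots before `j` are nonzero, so strong induction applies. -/
theorem HasNonzeroPivots.luEntry_ne_zero {n : ℕ} {A : Matrix (Fin n) (Fin n) ℝ}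
    (h : HasNonzeroPivots A) : ∀ j, j + 1 < n → luEntry (toArr A) j j ≠ 0 := by
  intro j
  induction j using Nat.strong_induction_on with
  | _ j ih =>
    intro hj h0
    apply h (j + 1) hj
    have e : A.submatrix (Fin.castLE hj.le) (Fin.castLE hj.le) =
        lowerFactor (j + 1) (luEntry (toArr A)) * upperFactor (j + 1) (luEntry (toArr A)) := by
      rw [lowerFactor_mul_upperFactor fun i hi => ih i (by omega) (by omega)]
      ext i k
      exact (toArr_apply A (Fin.castLE hj.le i) (Fin.castLE hj.le k)).symm
    rw [e, Matrix.det_mul, det_lowerFactor, one_mul, det_upperFactor]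
    exact Finset.prod_eq_zero (Finset.mem_univ (Fin.last j)) h0

/-! ## Correctness of the factorization -/

theorem Arr.store_apply (A : Arr) (i j : ℕ) (v : ℝ) (i' j' : ℕ) :
    A.store i j v i' j' = if i' = i ∧ j' = j then v else A i' j' := rfl

/-- The side conditions keep the summation index away from `i` and `j`. The loop therefore never
reads the entry it overwrites, and it accumulates an inner product. -/
theorem forRange_updateEntry_val {lo hi i j : ℕ} (hle : lo ≤ hi) (hi' : hi ≤ i ∨ i < lo)
    (hj' : hi ≤ j ∨ j < lo) (A : Arr) :
    (forRange lo hi (fun s => updateEntry i s j) A).val =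
      A.store i j (A i j - ∑ s ∈ Finset.Ico lo hi, A i s * A s j) := by
  refine forRange_val_induction hle
    (fun q B => B = A.store i j (A i j - ∑ s ∈ Finset.Ico lo q, A i s * A s j)) ?_ ?_
  · funext i' j'
    rw [Arr.store_apply]
    split_ifs with h
    · simp [h.1, h.2]
    · rfl
  · rintro s h1 h2 B rfl
    rw [updateEntry_val, Finset.sum_Ico_succ_top h1]
    funext i' j'
    have e1 : s ≠ i := by omega
    have e2 : s ≠ j := by omega
    simp only [Arr.store_apply, e1, e2, and_true, and_false, if_false, if_true]
    split_ifs
    · ring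
    · rfl

theorem forRange_updateRow_val {s i e : ℕ} (hs : s + 1 ≤ e) (hi : s < i) (A : Arr) :
    (forRange (s + 1) e (fun j => updateEntry i s j) A).val =
      fun i' j' => if i' = i ∧ s < j' ∧ j' < e then A i j' - A i s * A s j' else A i' j' := by
  refine forRange_val_induction hs
    (fun q B => B = fun i' j' =>
      if i' = i ∧ s < j' ∧ j' < q then A i j' - A i s * A s j' else A i' j') ?_ ?_
  · funext i' j'
    rw [if_neg (by omega)]
  · rintro j h1 h2 B rfl
    rw [updateEntry_val]
    funext i' j'
    rw [Arr.store_apply]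
    have e : s ≠ i := by omega
    simp only [e, lt_irrefl, and_false, false_and, if_false]
    by_cases c1 : i' = i ∧ j' = j
    · rw [if_pos c1, if_pos (by omega), c1.2]
    · rw [if_neg c1]
      by_cases c2 : i' = i ∧ s < j' ∧ j' < j
      · rw [if_pos c2, if_pos (by omega)]
      · rw [if_neg c2, if_neg (by omega)]

/-- One elimination stage of the banded factorization. -/
theorem eliminationStage_val {s e : ℕ} (hs : s + 1 ≤ e) (A : Arr) :
    (forRange (s + 1) e (fun i A => do
      let A ← divideEntry i s A
      forRange (s + 1) e (fun j => updateEntry i s j) A) A).val =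
      fun i j => if s < i ∧ i < e then
        (if j = s then A i s / A s s else
          if s < j ∧ j < e then A i j - A i s / A s s * A s j else A i j) else A i j := by
  refine forRange_val_induction hs
    (fun q B => B = fun i j => if s < i ∧ i < q then
        (if j = s then A i s / A s s else
          if s < j ∧ j < e then A i j - A i s / A s s * A s j else A i j) else A i j) ?_ ?_
  · funext i j
    rw [if_neg (by omega)]
  · rintro i h1 h2 B rfl
    rw [Counted.bind_val, divideEntry_val, forRange_updateRow_val hs (by omega)]
    funext i' j'
    have e1 : ¬ (s < i ∧ i < i) := by omega
    have e2 : ¬ (s < s ∧ s < i) := by omega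
    have e3 : s ≠ i := by omega
    simp only [Arr.store_apply, e1, e2, e3, if_false, false_and, true_and, if_true, and_self]
    by_cases c : i' = i
    · subst c
      have e4 : s < i' ∧ i' < i' + 1 := by omega
      simp only [e4, lt_irrefl, and_false, if_true, if_false, and_self]
      by_cases c1 : j' = s
      · subst c1
        simp
      · simp only [c1, if_false, true_and, and_false]
    · have e5 : (s < i' ∧ i' < i + 1) ↔ (s < i' ∧ i' < i) := by omega
      simp only [c, false_and, if_false, e5]

/-- The banded factorization computes the entries of the triangular factors. -/
theorem bandedLU_val {A B : Arr} {p lo hi : ℕ} (hle : lo ≤ hi)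
    (hB : ∀ i j, lo ≤ i → i < hi → lo ≤ j → j < hi → B i j = schurEntry A lo i j)
    (hband : ∀ i j, lo ≤ i → i < hi → lo ≤ j → j < hi → (i + p < j ∨ j + p < i) →
      luEntry A i j = 0)
    (hpiv : ∀ j, j + 1 < hi → luEntry A j j ≠ 0) (i j : ℕ) :
    (bandedLU p lo hi B).val i j =
      if (lo ≤ i ∧ i < hi) ∧ lo ≤ j ∧ j < hi then luEntry A i j else B i j := by
  -- After the columns before `q`, entries with `min i j < q` are final, and the remaining ones hold
  -- the Schur complement of order `q`.
  have H := forRange_val_induction hle (A := B)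
    (body := fun s =>
      forRange (s + 1) (min hi (s + p + 1)) fun i A => do
        let A ← divideEntry i s A
        forRange (s + 1) (min hi (s + p + 1)) (fun j => updateEntry i s j) A)
    (fun q D => ∀ i j, D i j = if (lo ≤ i ∧ i < hi) ∧ lo ≤ j ∧ j < hi then
      (if min i j < q then luEntry A i j else schurEntry A q i j) else B i j) ?_ ?_
  · rw [bandedLU, H]
    by_cases c : (lo ≤ i ∧ i < hi) ∧ lo ≤ j ∧ j < hi
    · rw [if_pos c, if_pos c, if_pos (by omega)]
    · rw [if_neg c, if_neg c]
  · intro i j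
    split_ifs with c1 c2
    · omega
    · exact hB i j c1.1.1 c1.1.2 c1.2.1 c1.2.2
    · rfl
  · intro s h1 h2 D hD i j
    rw [eliminationStage_val (by omega)]
    beta_reduce
    by_cases c : (lo ≤ i ∧ i < hi) ∧ lo ≤ j ∧ j < hi
    swap
    · rw [if_neg c, hD i j, if_neg c]
      split_ifs <;> first | rfl | omega
    rw [if_pos c]
    have hss : D s s = luEntry A s s := by
      rw [hD, if_pos (by omega), if_neg (by omega), luEntry_of_le A le_rfl]
    by_cases c1 : s < i ∧ i < min hi (s + p + 1)
    · rw [if_pos c1]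
      have his : D i s / D s s = luEntry A i s := by
        rw [hss, hD, if_pos (by omega), if_neg (by omega), luEntry_of_lt A c1.1]
      rw [his]
      by_cases c2 : j = s
      · rw [if_pos c2, if_pos (by omega), c2]
      rw [if_neg c2]
      by_cases c3 : s < j ∧ j < min hi (s + p + 1)
      · rw [if_pos c3, if_neg (by omega), hD, if_pos c, if_neg (by omega), schurEntry_succ,
          hD s j, if_pos (by omega), if_neg (by omega), luEntry_of_le A c3.1.le]
      · rw [if_neg c3, hD, if_pos c]
        by_cases c4 : min i j < s
        · rw [if_pos c4, if_pos (by omega)]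
        · rw [if_neg c4, if_neg (by omega), schurEntry_succ,
            hband s j h1 h2 c.2.1 c.2.2 (by omega), mul_zero, sub_zero]
    · rw [if_neg c1, hD, if_pos c]
      by_cases c4 : min i j < s
      · rw [if_pos c4, if_pos (by omega)]
      rw [if_neg c4]
      by_cases c5 : i = s
      · rw [if_pos (by omega), c5, luEntry_of_le A (by omega)]
      have h0 : luEntry A i s = 0 := hband i s c.1.1 c.1.2 h1 h2 (by omega)
      -- The loop skips this row as lying below the band. Its multiplier is zero, so skipping is
      -- exact away from column `s`. In column `s` the stored Schur entry must itself be the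
      -- multiplier `0`, which follows because the pivot is nonzero.
      by_cases c6 : j = s
      · have h3 := luEntry_of_lt A (i := i) (j := s) (by omega)
        rw [h0, eq_comm, div_eq_zero_iff] at h3
        rw [if_pos (by omega), c6, h0]
        exact h3.resolve_right (hpiv s (by omega))
      · rw [if_neg (by omega), schurEntry_succ, h0, zero_mul, sub_zero]

/-- Lets the substitution loops start at `i - p` or `j - p`: the omitted products contain a factor
outside the band. -/
theorem schurEntry_eq_sum_Ico {A : Arr} {lo q i j : ℕ} (hle : lo ≤ q)
    (h : ∀ s < lo, luEntry A i s * luEntry A s j = 0) :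
    schurEntry A q i j = A i j - ∑ s ∈ Finset.Ico lo q, luEntry A i s * luEntry A s j := by
  rw [schurEntry, ← Finset.sum_range_add_sum_Ico _ hle, Finset.sum_eq_zero (s := Finset.range lo)
    (fun s hs => h s (Finset.mem_range.1 hs)), zero_add]

/-- A double loop that fills a rectangle row by row. -/
theorem forRange_fill_rows {a a' c c' : ℕ} (ha : a ≤ a') (hc : c ≤ c')
    {body : ℕ → ℕ → Arr → Counted Arr} {B V : Arr}
    (h : ∀ i j, a ≤ i → i < a' → c ≤ j → j < c' → ∀ D : Arr,
      (∀ i' j', D i' j' = if (a ≤ i' ∧ i' < a' ∧ c ≤ j' ∧ j' < c') ∧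
        (i' < i ∨ i' = i ∧ j' < j) then V i' j' else B i' j') →
      (body i j D).val = D.store i j (V i j)) (i j : ℕ) :
    (forRange a a' (fun i => forRange c c' (body i)) B).val i j =
      if a ≤ i ∧ i < a' ∧ c ≤ j ∧ j < c' then V i j else B i j := by
  have H := forRange_val_induction ha (A := B) (body := fun i => forRange c c' (body i))
    (fun q D => ∀ i j, D i j =
      if (a ≤ i ∧ i < a' ∧ c ≤ j ∧ j < c') ∧ i < q then V i j else B i j) ?_ ?_
  · rw [H]
    congr 1
    simp only [eq_iff_iff]; omega
  · intro i j
    rw [if_neg (by omega)]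
  · intro q h1 h2 D hD
    have H' := forRange_val_induction hc (A := D) (body := body q)
      (fun r D => ∀ i j, D i j = if (a ≤ i ∧ i < a' ∧ c ≤ j ∧ j < c') ∧
        (i < q ∨ i = q ∧ j < r) then V i j else B i j) ?_ ?_
    · intro i j
      rw [H']
      congr 1
      simp only [eq_iff_iff]; omega
    · intro i j
      rw [hD]
      congr 1
      simp only [eq_iff_iff]; omega
    · intro r h3 h4 D hD i j
      rw [h q r h1 h2 h3 h4 D hD, Arr.store_apply, hD]
      by_cases c1 : i = q ∧ j = r
      · rw [if_pos c1, if_pos (by omega), c1.1, c1.2]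
      · rw [if_neg c1]
        congr 1
        simp only [eq_iff_iff]; omega

/-- A double loop that fills a rectangle column by column. -/
theorem forRange_fill_cols {a a' c c' : ℕ} (ha : a ≤ a') (hc : c ≤ c')
    {body : ℕ → ℕ → Arr → Counted Arr} {B V : Arr}
    (h : ∀ i j, a ≤ i → i < a' → c ≤ j → j < c' → ∀ D : Arr,
      (∀ i' j', D i' j' = if (a ≤ i' ∧ i' < a' ∧ c ≤ j' ∧ j' < c') ∧
        (j' < j ∨ j' = j ∧ i' < i) then V i' j' else B i' j') →
      (body j i D).val = D.store i j (V i j)) (i j : ℕ) :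
    (forRange c c' (fun j => forRange a a' (body j)) B).val i j =
      if a ≤ i ∧ i < a' ∧ c ≤ j ∧ j < c' then V i j else B i j := by
  have H := forRange_val_induction hc (A := B) (body := fun j => forRange a a' (body j))
    (fun q D => ∀ i j, D i j =
      if (a ≤ i ∧ i < a' ∧ c ≤ j ∧ j < c') ∧ j < q then V i j else B i j) ?_ ?_
  · rw [H]
    congr 1
    simp only [eq_iff_iff]; omega
  · intro i j
    rw [if_neg (by omega)]
  · intro q h1 h2 D hD
    have H' := forRange_val_induction ha (A := D) (body := body q)
      (fun r D => ∀ i j, D i j = if (a ≤ i ∧ i < a' ∧ c ≤ j ∧ j < c') ∧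
        (j < q ∨ j = q ∧ i < r) then V i j else B i j) ?_ ?_
    · intro i j
      rw [H']
      congr 1
      simp only [eq_iff_iff]; omega
    · intro i j
      rw [hD]
      congr 1
      simp only [eq_iff_iff]; omega
    · intro r h3 h4 D hD i j
      rw [h r q h3 h4 h1 h2 D hD, Arr.store_apply, hD]
      by_cases c1 : i = r ∧ j = q
      · rw [if_pos c1, if_pos (by omega), c1.1, c1.2]
      · rw [if_neg c1]
        congr 1
        simp only [eq_iff_iff]; omega

theorem solveX_val {A B : Arr} {p b n : ℕ} (hbn : b ≤ n)
    (hF : ∀ i j, i < b → j < b → B i j = luEntry A i j)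
    (hP : ∀ i j, i < b → b ≤ j → j < n → B i j = A i j)
    (hband : ∀ i j, i < b → j < b → (i + p < j ∨ j + p < i) → luEntry A i j = 0) (i j : ℕ) :
    (solveX p b n B).val i j =
      if 0 ≤ i ∧ i < b ∧ b ≤ j ∧ j < n then luEntry A i j else B i j := by
  refine forRange_fill_cols (Nat.zero_le b) hbn (fun i j _ hi hj hjn D hD => ?_) i j
  rw [forRange_updateEntry_val (by omega) (by omega) (by omega), luEntry_of_le A (by omega),
    schurEntry_eq_sum_Ico (lo := i - p) (by omega), hD i j, if_neg (by omega), hP i j hi hj hjn]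
  · congr 2
    refine Finset.sum_congr rfl fun s hs => ?_
    rw [Finset.mem_Ico] at hs
    rw [hD i s, if_neg (by omega), hF i s hi (by omega), hD s j, if_pos (by omega)]
  · intro s hs
    rw [hband i s hi (by omega) (by omega), zero_mul]

theorem solveY_val {A B : Arr} {p b n : ℕ} (hbn : b ≤ n)
    (hF : ∀ i j, i < b → j < b → B i j = luEntry A i j)
    (hQ : ∀ i j, b ≤ i → i < n → j < b → B i j = A i j)
    (hband : ∀ i j, i < b → j < b → (i + p < j ∨ j + p < i) → luEntry A i j = 0) (i j : ℕ) :
    (solveY p b n B).val i j =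
      if b ≤ i ∧ i < n ∧ 0 ≤ j ∧ j < b then luEntry A i j else B i j := by
  refine forRange_fill_rows hbn (Nat.zero_le b) (fun i j hi hin _ hj D hD => ?_) i j
  rw [Counted.bind_val, forRange_updateEntry_val (by omega) (by omega) (by omega), divideEntry_val,
    luEntry_of_lt A (by omega), schurEntry_eq_sum_Ico (lo := j - p) (by omega)]
  · have e1 : ∑ s ∈ Finset.Ico (j - p) j, D i s * D s j =
        ∑ s ∈ Finset.Ico (j - p) j, luEntry A i s * luEntry A s j := by
      refine Finset.sum_congr rfl fun s hs => ?_
      rw [Finset.mem_Ico] at hs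
      rw [hD i s, if_pos (by omega), hD s j, if_neg (by omega), hF s j (by omega) hj]
    have e2 : j ≠ i := by omega
    have e3 : D i j = A i j := by rw [hD, if_neg (by omega), hQ i j hi hin hj]
    have e4 : D j j = luEntry A j j := by rw [hD, if_neg (by omega), hF j j hj hj]
    funext i' j'
    simp only [Arr.store_apply, e2, false_and, if_false, and_self, if_true, e1,
      e3, e4]
    split_ifs <;> rfl
  · intro s hs
    rw [hband s j (by omega) hj (by omega), mul_zero]

theorem formSchur_val {A B : Arr} {b n : ℕ} (hbn : b ≤ n)
    (hX : ∀ i j, i < b → b ≤ j → j < n → B i j = luEntry A i j)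
    (hY : ∀ i j, b ≤ i → i < n → j < b → B i j = luEntry A i j)
    (hS : ∀ i j, b ≤ i → i < n → b ≤ j → j < n → B i j = A i j) (i j : ℕ) :
    (formSchur b n B).val i j =
      if b ≤ i ∧ i < n ∧ b ≤ j ∧ j < n then schurEntry A b i j else B i j := by
  refine forRange_fill_rows hbn hbn (fun i j hi hin hj hjn D hD => ?_) i j
  rw [forRange_updateEntry_val (by omega) (by omega) (by omega),
    schurEntry_eq_sum_Ico (lo := 0) (by omega) (by omega), hD i j, if_neg (by omega),
    hS i j hi hin hj hjn]
  congr 2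
  refine Finset.sum_congr rfl fun s hs => ?_
  rw [Finset.mem_Ico] at hs
  rw [hD i s, if_neg (by omega), hY i s hi hin (by omega), hD s j, if_neg (by omega),
    hX s j (by omega) hj hjn]

/-- The four blocks of the factors obey the same recursion as `luEntry`, read blockwise. Each stage
fills one block with final entries, except `formSchur`, which prepares the input of the last
elimination. -/
theorem cornerLU_val {A : Arr} {p n : ℕ}
    (hband : ∀ i j, i < n - min p n → j < n - min p n → (i + p < j ∨ j + p < i) → A i j = 0)
    (hpiv : ∀ j, j + 1 < n → luEntry A j j ≠ 0) (i j : ℕ) (hi : i < n) (hj : j < n) :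
    (cornerLU p n A).val i j = luEntry A i j := by
  have hb := luEntry_eq_zero_of_banded hband
  have hk : n - min p n + min p n = n := by omega
  simp only [cornerLU, Counted.bind_val]
  generalize n - min p n = b at *
  generalize min p n = k at *
  have E1 := bandedLU_val (A := A) (B := A) (p := p) (lo := 0) (hi := b) (Nat.zero_le b)
    (fun i j _ _ _ _ => (schurEntry_zero A i j).symm)
    (fun i j _ h1 _ h2 h3 => hb i j h1 h2 h3) (fun j hj => hpiv j (by omega))
  generalize (bandedLU p 0 b A).val = A₁ at *
  have E2 := solveX_val (A := A) (B := A₁) (p := p) (b := b) (n := n) (by omega)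
    (fun i j h1 h2 => by rw [E1, if_pos (by omega)])
    (fun i j h1 h2 h3 => by rw [E1, if_neg (by omega)]) hb
  generalize (solveX p b n A₁).val = A₂ at *
  have E3 := solveY_val (A := A) (B := A₂) (p := p) (b := b) (n := n) (by omega)
    (fun i j h1 h2 => by rw [E2, if_neg (by omega), E1, if_pos (by omega)])
    (fun i j h1 h2 h3 => by rw [E2, if_neg (by omega), E1, if_neg (by omega)]) hb
  generalize (solveY p b n A₂).val = A₃ at *
  have E4 := formSchur_val (A := A) (B := A₃) (b := b) (n := n) (by omega)
    (fun i j h1 h2 h3 => by rw [E3, if_neg (by omega), E2, if_pos (by omega)])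
    (fun i j h1 h2 h3 => by rw [E3, if_pos (by omega)])
    (fun i j h1 h2 h3 h4 => by
      rw [E3, if_neg (by omega), E2, if_neg (by omega), E1, if_neg (by omega)])
  generalize (formSchur b n A₃).val = A₄ at *
  -- The last block has size `k` and is eliminated with bandwidth `k`, so no pair of indices lies
  -- outside the band.
  rw [bandedLU_val (A := A) (by omega)
    (fun i j h1 h2 h3 h4 => by rw [E4, if_pos (by omega)])
    (fun i j h1 h2 h3 h4 h5 => by omega) hpiv]
  split_ifs with c
  · rfl
  rw [E4, if_neg (by omega), E3]
  split_ifs with c1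
  · rfl
  rw [E2]
  split_ifs with c2
  · rfl
  rw [E1, if_pos (by omega)]

/-- The factors computed from a matrix that is banded up to corners reproduce the matrix. -/
theorem IsBandedUpToCorners.lowerFactor_mul_upperFactor {n p : ℕ} {A : Matrix (Fin n) (Fin n) ℝ}
    (hA : IsBandedUpToCorners p A) (hpiv : HasNonzeroPivots A) :
    lowerFactor n (runLU p A).val * upperFactor n (runLU p A).val = A := by
  have key : ∀ i j : Fin n, (runLU p A).val i j = luEntry (toArr A) i j := fun i j =>
    cornerLU_val (fun i j h1 h2 h3 => by
      by_contra h0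
      have hin : i < n := by omega
      have hjn : j < n := by omega
      -- Inside the block `B` the corner alternatives are impossible: both indices are below `n -
      -- p`, or `B` is empty when `p ≥ n`.
      have := hA ⟨i, hin⟩ ⟨j, hjn⟩ (by rw [← toArr_apply A]; exact h0)
      simp only at this
      omega) hpiv.luEntry_ne_zero i j i.2 j.2
  have e1 : lowerFactor n (runLU p A).val = lowerFactor n (luEntry (toArr A)) := by
    ext i j; simp only [lowerFactor, key]
  have e2 : upperFactor n (runLU p A).val = upperFactor n (luEntry (toArr A)) := by
    ext i j; simp only [upperFactor, key]
  rw [e1, e2, _root_.lowerFactor_mul_upperFactor hpiv.luEntry_ne_zero]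
  ext i j
  exact toArr_apply A i j

/-! ## Merging happens only near the boundary -/

theorem regUnion_eq (S T : Set Plane) : regUnion S T = interior (closure (S ∪ T)) := by
  rw [regUnion, exteriorSet, exteriorSet, interior_compl (s := S ∪ T), compl_compl]

theorem isOpen_regUnion (S T : Set Plane) : IsOpen (regUnion S T) := isOpen_interior

theorem subset_regUnion_left {S T : Set Plane} (hS : IsOpen S) : S ⊆ regUnion S T := by
  rw [regUnion_eq]
  exact interior_maximal (subset_union_left.trans subset_closure) hS

theorem isOpen_gridCell (h : ℝ) (i : Idx) : IsOpen (gridCell h i) := by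
  have : gridCell h i = ⋂ d, {x : Plane | (i d : ℝ) * h < x d ∧ x d < ((i d : ℝ) + 1) * h} := by
    ext x; simp [gridCell]
  rw [this]
  refine isOpen_iInter_of_finite fun d => ?_
  have hc : Continuous fun x : Plane => x d := by fun_prop
  exact (isOpen_lt continuous_const hc).inter (isOpen_lt hc continuous_const)

theorem convex_gridCell (h : ℝ) (i : Idx) : Convex ℝ (gridCell h i) := by
  intro x hx y hy a b ha hb hab d
  have h1 := hx d
  have h2 := hy d
  simp only [PiLp.add_apply, PiLp.smul_apply, smul_eq_mul]
  have := convex_Ioo ((i d : ℝ) * h) (((i d : ℝ) + 1) * h) h1 h2 ha hb hab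
  simpa using this

theorem volume_real_gridCell {h : ℝ} (hh : 0 < h) (i : Idx) :
    volume.real (gridCell h i) = h ^ 2 := by
  have e : gridCell h i = (WithLp.ofLp : Plane → Fin 2 → ℝ) ⁻¹'
      (Set.pi univ fun d => Ioo ((i d : ℝ) * h) (((i d : ℝ) + 1) * h)) := by
    ext x; simp [gridCell]
  rw [e, Measure.real, (PiLp.volume_preserving_ofLp (Fin 2)).measure_preimage
    (MeasurableSet.univ_pi fun _ => measurableSet_Ioo).nullMeasurableSet, Real.volume_pi_Ioo,
    Fin.prod_univ_two, ENNReal.toReal_mul, ENNReal.toReal_ofReal (by nlinarith),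
    ENNReal.toReal_ofReal (by nlinarith)]
  ring

theorem gridCell_nonempty {h : ℝ} (hh : 0 < h) (i : Idx) : (gridCell h i).Nonempty :=
  ⟨cellCenter h i, fun d => by simp only [cellCenter]; constructor <;> nlinarith⟩

/-- The grid cells next to `j` that meet `Ω` lie in `Ω`, and so does the cell `j`. -/
def IsInteriorIdx (Ω : Set Plane) (h : ℝ) (j : Idx) : Prop :=
  gridCell h j ⊆ Ω ∧
    ∀ k : Idx, ∑ d, |j d - k d| = 1 → (gridCell h k ∩ Ω).Nonempty → gridCell h k ⊆ Ω

/-- The invariants of the merging algorithm. -/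
structure MergeInvariant (Ω : Set Plane) (h : ℝ) (σ : CutState) : Prop where
  meets : ∀ i, (σ i).Nonempty → (gridCell h i ∩ Ω).Nonempty
  isOpen : ∀ i, ∀ K ∈ σ i, IsOpen K ∧ K ⊆ Ω
  full : ∀ i, gridCell h i ⊆ Ω → ∃ S, σ i = {S} ∧ gridCell h i ⊆ S
  unchanged : ∀ i, IsInteriorIdx Ω h i → σ i = {gridCell h i}

theorem initialState_of_subset {Ω : Set Plane} {h : ℝ} (hh : 0 < h) {i : Idx}
    (hi : gridCell h i ⊆ Ω) : initialState Ω h i = {gridCell h i} := by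
  have e : gridCell h i ∩ Ω = gridCell h i := inter_eq_left.2 hi
  obtain ⟨x₀, hx₀⟩ := gridCell_nonempty hh i
  ext K
  simp only [initialState, e, mem_ofPred_eq, mem_singleton_iff]
  constructor
  · rintro ⟨x, hx, rfl⟩
    exact (convex_gridCell h i).isPreconnected.connectedComponentIn hx
  · rintro rfl
    exact ⟨x₀, hx₀, ((convex_gridCell h i).isPreconnected.connectedComponentIn hx₀).symm⟩

theorem mergeInvariant_initialState {Ω : Set Plane} {h : ℝ} (hh : 0 < h) (hΩ : IsOpen Ω) :
    MergeInvariant Ω h (initialState Ω h) where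
  meets := by
    rintro i ⟨K, x, hx, -⟩
    exact ⟨x, hx⟩
  isOpen := by
    rintro i K ⟨x, hx, rfl⟩
    exact ⟨((isOpen_gridCell h i).inter hΩ).connectedComponentIn,
      (connectedComponentIn_subset _ _).trans inter_subset_right⟩
  full := fun i hi => ⟨_, initialState_of_subset hh hi, subset_rfl⟩
  unchanged := fun i hi => initialState_of_subset hh hi.1

/-- The source cell is not contained in `Ω`, so a full cell can only be a target and only grows. An
interior cell cannot even be a target: the source would be a neighbor that meets `Ω`, hence full. -/
theorem MergeInvariant.mergeInto {Ω : Set Plane} {h : ℝ} (hΩ : interior (closure Ω) = Ω)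
    {σ : CutState} (hσ : MergeInvariant Ω h σ) {i : Idx} {K : Set Plane} {q : Idx × Set Plane}
    (hK : K ∈ σ i) (hi : ¬ gridCell h i ⊆ Ω) (hq : q ∈ neighborComponents σ i K) :
    MergeInvariant Ω h (_root_.mergeInto σ i K q) := by
  obtain ⟨hq1, hq2, -⟩ := hq
  -- Regularity of `Ω` enters here: taking the interior of the closure does not leave `Ω`.
  have hU : regUnion q.2 K ⊆ Ω := by
    rw [regUnion_eq, ← hΩ]
    exact interior_mono (closure_mono (union_subset (hσ.isOpen _ _ hq1).2 (hσ.isOpen _ _ hK).2))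
  constructor
  · intro j hj
    unfold _root_.mergeInto at hj
    split_ifs at hj with h1 h2
    · exact hσ.meets j (h1 ▸ ⟨_, hq1⟩)
    · exact hσ.meets j (hj.mono sdiff_subset)
    · exact hσ.meets j hj
  · intro j L hL
    unfold _root_.mergeInto at hL
    split_ifs at hL with h1 h2
    · rcases hL with rfl | hL
      · exact ⟨isOpen_regUnion _ _, hU⟩
      · exact hσ.isOpen j L hL.1
    · exact hσ.isOpen j L hL.1
    · exact hσ.isOpen j L hL
  · intro j hj
    obtain ⟨S, hS, hjS⟩ := hσ.full j hj
    unfold _root_.mergeInto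
    split_ifs with h1 h2
    · subst h1
      have e : q.2 = S := by rw [hS] at hq1; exact hq1
      subst e
      refine ⟨regUnion q.2 K, ?_, hjS.trans (subset_regUnion_left (hσ.isOpen _ _ hq1).1)⟩
      rw [hS, sdiff_self, insert_empty_eq]
    · exact absurd (h2 ▸ hj) hi
    · exact ⟨S, hS, hjS⟩
  · intro j hj
    unfold _root_.mergeInto
    split_ifs with h1 h2
    · exact absurd (hj.2 i (h1 ▸ hq2) (hσ.meets i ⟨K, hK⟩)) hi
    · exact absurd (h2 ▸ hj.1) hi
    · exact hσ.unchanged j hj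

/-- Neither rule removes a component from a full cell: it has only one component, which excludes
splitting, and that component has volume at least `h ^ 2 > ε * h ^ 2`. Boundedness of `Ω` makes the
volumes finite, so that they are monotone. -/
theorem MergeInvariant.step {Ω : Set Plane} {h ε : ℝ} (hh : 0 < h) (hε : ε < 1)
    (hΩ : interior (closure Ω) = Ω) (hb : Bornology.IsBounded Ω) {σ τ : CutState}
    (hσ : MergeInvariant Ω h σ) (hst : MergeStep h ε σ τ) : MergeInvariant Ω h τ := by
  cases hst with
  | split i K M q hK hM hKM hmax hq =>
    refine hσ.mergeInto hΩ hK (fun hi => ?_) hq.1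
    obtain ⟨S, hS, -⟩ := hσ.full i hi
    rw [hS] at hK hM
    exact hKM (hK.trans hM.symm)
  | small i K q hsub hK hsmall hq =>
    refine hσ.mergeInto hΩ hK (fun hi => ?_) hq.1
    obtain ⟨S, hS, hiS⟩ := hσ.full i hi
    have e : K = S := by rw [hS] at hK; exact hK
    have h1 : volume.real (gridCell h i) ≤ volume.real K :=
      measureReal_mono (e ▸ hiS) (hb.subset (hσ.isOpen i K hK).2).measure_lt_top.ne
    rw [volume_real_gridCell hh] at h1
    nlinarith [pow_pos hh 2]

theorem mergeInvariant_of_reflTransGen {Ω : Set Plane} {h ε : ℝ} (hh : 0 < h) (hε : ε < 1)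
    (hΩ : interior (closure Ω) = Ω) (hb : Bornology.IsBounded Ω) {σ : CutState}
    (hs : Relation.ReflTransGen (MergeStep h ε) (initialState Ω h) σ) : MergeInvariant Ω h σ := by
  induction hs with
  | refl => exact mergeInvariant_initialState hh (hΩ ▸ isOpen_interior)
  | tail _ hst ih => exact ih.step hh hε hΩ hb hst

/-! ## Cells that are not symmetric finite-volume cells are close to the boundary -/

theorem Plane.dist_le_sum (x y : Plane) : dist x y ≤ |x 0 - y 0| + |x 1 - y 1| := by
  rw [EuclideanSpace.dist_eq, Fin.sum_univ_two, Real.dist_eq, Real.dist_eq]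
  refine Real.sqrt_le_iff.2 ⟨by positivity, ?_⟩
  nlinarith [mul_nonneg (abs_nonneg (x 0 - y 0)) (abs_nonneg (x 1 - y 1))]

theorem Plane.abs_sub_le_dist (x y : Plane) (d : Fin 2) : |x d - y d| ≤ dist x y := by
  have := PiLp.norm_apply_le (x - y) d
  rwa [PiLp.sub_apply, Real.norm_eq_abs, ← dist_eq_norm] at this

theorem abs_sub_cellCenter_le {h : ℝ} {i k : Idx} {n : ℝ} (hik : ∀ d, |(k d : ℝ) - i d| ≤ n)
    {x : Plane} (hx : x ∈ gridCell h k) (hh : 0 < h) (d : Fin 2) :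
    |x d - cellCenter h i d| ≤ (n + 1 / 2) * h := by
  obtain ⟨h1, h2⟩ := hx d
  obtain ⟨h3, h4⟩ := abs_le.1 (hik d)
  simp only [cellCenter]
  rw [abs_le]
  constructor <;> nlinarith

theorem abs_sub_le_of_mem_symmetricStencil {b : ℝ} {i j : Idx} (h : j ∈ symmetricStencil b i)
    (d : Fin 2) : |j d - i d| ≤ 2 := by
  rcases h with ⟨-, e, m, hm, rfl⟩ | ⟨-, m₁, m₂, h1, h2, rfl⟩
  · fin_cases d <;> fin_cases e <;> simp [unitIdx, hm]
  · fin_cases d <;> simp [unitIdx, h1, h2]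

/-- A set missing the frontier would be separated by `U` and the complement of its closure. -/
theorem inter_frontier_nonempty_of_isPreconnected {X : Type*} [TopologicalSpace X] {Q U : Set X}
    (hU : IsOpen U) (hQ : IsPreconnected Q) (h1 : (Q ∩ U).Nonempty)
    (h2 : (Q ∩ Uᶜ).Nonempty) : (Q ∩ frontier U).Nonempty := by
  by_contra h
  rw [not_nonempty_iff_eq_empty, ← disjoint_iff_inter_eq_empty, disjoint_left] at h
  have hsub : Q ⊆ U ∪ (closure U)ᶜ := fun x hx => by
    by_contra hc
    rw [mem_union, not_or, notMem_compl_iff] at hc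
    exact h hx (hU.frontier_eq ▸ ⟨hc.2, hc.1⟩)
  obtain ⟨x, hx, hxU⟩ := h2
  obtain ⟨y, -, hy1, hy2⟩ := hQ U (closure U)ᶜ hU isClosed_closure.isOpen_compl hsub h1
    ⟨x, hx, (hsub hx).resolve_left hxU⟩
  exact hy2 (subset_closure hy1)

/-- A box around the cell meets both `Ω` and its complement, hence the frontier. Being a ghost cell
plays no role, since a stencil cell that is not regular suffices. -/
theorem exists_frontier_near_plgCell {Ω : Set Plane} (hΩ : interior (closure Ω) = Ω)
    (hb : Bornology.IsBounded Ω) {E : EllipticProblem} {h ε : ℝ} (hh : 0 < h) (hε : ε < 1)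
    {𝒞 : Idx → Set Plane} (h𝒞 : IsMergedCutCells Ω h ε 𝒞) {i : Idx} (hi : i ∈ plgCells Ω E h 𝒞) :
    ∃ x ∈ frontier Ω, dist (cellCenter h i) x ≤ 7 * h := by
  obtain ⟨σ, hσ, -, -, h𝒞σ⟩ := h𝒞
  have hinv := mergeInvariant_of_reflTransGen hh hε hΩ hb hσ
  obtain ⟨hne, hst⟩ := hi
  push Not at hst
  obtain ⟨j, hj, hreg, -⟩ := hst
  have hji := abs_sub_le_of_mem_symmetricStencil hj
  have hin : (gridCell h i ∩ Ω).Nonempty := by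
    refine hinv.meets i ?_
    rw [h𝒞σ] at hne
    obtain ⟨x, K, hK, -⟩ := hne
    exact ⟨K, hK⟩
  -- The radius 3 is 2 for the stencil plus 1 for the neighbor that spoils interiority. With the
  -- half cell this gives `7 / 2 * h` per coordinate, and the sum of the two coordinates gives `7 *
  -- h`.
  obtain ⟨k, hki, hk⟩ : ∃ k : Idx, (∀ d, |k d - i d| ≤ 3) ∧ ¬ gridCell h k ⊆ Ω := by
    have hni : ¬ IsInteriorIdx Ω h j := fun hint => by
      apply hreg
      rw [IsRegularCell, h𝒞σ, hinv.unchanged j hint, sUnion_singleton]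
    rw [IsInteriorIdx, not_and_or] at hni
    rcases hni with hni | hni
    · exact ⟨j, fun d => (hji d).trans (by norm_num), hni⟩
    · push Not at hni
      obtain ⟨k, hk1, -, hk2⟩ := hni
      refine ⟨k, fun d => ?_, hk2⟩
      have h1 : |j d - k d| ≤ 1 := by
        rw [← hk1]
        exact Finset.single_le_sum (f := fun d => |j d - k d|) (fun _ _ => abs_nonneg _)
          (Finset.mem_univ d)
      have h2 := hji d
      rw [abs_le] at *
      constructor <;> omega
  set Q : Set Plane := {x | ∀ d, |x d - cellCenter h i d| ≤ (3 + 1 / 2) * h} with hQ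
  have hQc : Convex ℝ Q := by
    intro x hx y hy a b ha hb hab d
    have h1 := hx d
    have h2 := hy d
    rw [abs_sub_comm, ← Real.dist_eq, ← Metric.mem_closedBall'] at h1 h2 ⊢
    exact convex_closedBall _ _ h1 h2 ha hb hab
  have hQ1 : (Q ∩ Ω).Nonempty := by
    obtain ⟨x, hx, hxΩ⟩ := hin
    exact ⟨x, fun d => abs_sub_cellCenter_le (n := 3) (by simp) hx hh d, hxΩ⟩
  have hQ2 : (Q ∩ Ωᶜ).Nonempty := by
    obtain ⟨x, hx, hxΩ⟩ := not_subset.1 hk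
    exact ⟨x, fun d => abs_sub_cellCenter_le (n := 3) (fun d => by exact_mod_cast hki d) hx hh d,
      hxΩ⟩
  obtain ⟨x, hxQ, hx⟩ := inter_frontier_nonempty_of_isPreconnected (hΩ ▸ isOpen_interior) hQc.isPreconnected hQ1 hQ2
  refine ⟨x, hx, ?_⟩
  rw [dist_comm]
  refine (Plane.dist_le_sum _ _).trans ?_
  linarith [hxQ 0, hxQ 1]

/-! ## Piecewise continuously differentiable Jordan curves -/

namespace JordanCurve

variable (γ : JordanCurve)

theorem exists_piece_right {t : ℝ} (ht : t ∈ Ico (0 : ℝ) 1) :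
    ∃ k : Fin γ.pieces, t ∈ Ico (γ.knot k.castSucc) (γ.knot k.succ) := by
  suffices H : ∀ m : Fin (γ.pieces + 1), t < γ.knot m →
      ∃ k : Fin γ.pieces, t ∈ Ico (γ.knot k.castSucc) (γ.knot k.succ) from
    H (Fin.last _) (by rw [γ.knot_last]; exact ht.2)
  intro m
  induction m using Fin.induction with
  | zero => intro h; rw [γ.knot_zero] at h; exact absurd ht.1 (not_le.2 h)
  | succ k ih =>
    intro h
    rcases lt_or_ge t (γ.knot k.castSucc) with h1 | h1
    · exact ih h1
    · exact ⟨k, h1, h⟩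

theorem exists_piece_left {t : ℝ} (ht : t ∈ Ioc (0 : ℝ) 1) :
    ∃ k : Fin γ.pieces, t ∈ Ioc (γ.knot k.castSucc) (γ.knot k.succ) := by
  suffices H : ∀ m : Fin (γ.pieces + 1), t ≤ γ.knot m →
      ∃ k : Fin γ.pieces, t ∈ Ioc (γ.knot k.castSucc) (γ.knot k.succ) from
    H (Fin.last _) (by rw [γ.knot_last]; exact ht.2)
  intro m
  induction m using Fin.induction with
  | zero => intro h; rw [γ.knot_zero] at h; exact absurd ht.1 (not_lt.2 h)
  | succ k ih =>
    intro h
    rcases le_or_gt t (γ.knot k.castSucc) with h1 | h1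
    · exact ih h1
    · exact ⟨k, h1, h⟩

theorem hasDerivAt_piece (k : Fin γ.pieces) (t : ℝ) :
    HasDerivAt (γ.piece k) (deriv (γ.piece k) t) t :=
  ((γ.piece_contDiff k).differentiable (by norm_num) t).hasDerivAt

theorem continuous_deriv_piece (k : Fin γ.pieces) : Continuous (deriv (γ.piece k)) :=
  (γ.piece_contDiff k).continuous_deriv (by norm_num)

theorem hasDerivWithinAt_right {k : Fin γ.pieces} {t : ℝ}
    (ht : t ∈ Ico (γ.knot k.castSucc) (γ.knot k.succ)) :
    HasDerivWithinAt γ.toFun (deriv (γ.piece k) t) (Ici t) t := by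
  refine (γ.hasDerivAt_piece k t).hasDerivWithinAt.congr_of_eventuallyEq ?_
    (γ.eq_piece k t ⟨ht.1, ht.2.le⟩)
  filter_upwards [Icc_mem_nhdsGE ht.2] with s hs
  exact γ.eq_piece k s ⟨ht.1.trans hs.1, hs.2⟩

theorem hasDerivWithinAt_left {k : Fin γ.pieces} {t : ℝ}
    (ht : t ∈ Ioc (γ.knot k.castSucc) (γ.knot k.succ)) :
    HasDerivWithinAt γ.toFun (deriv (γ.piece k) t) (Iic t) t := by
  refine (γ.hasDerivAt_piece k t).hasDerivWithinAt.congr_of_eventuallyEq ?_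
    (γ.eq_piece k t ⟨ht.1.le, ht.2⟩)
  filter_upwards [Icc_mem_nhdsLE ht.1] with s hs
  exact γ.eq_piece k s ⟨hs.1, hs.2.trans ht.2⟩

theorem continuousOn : ContinuousOn γ.toFun (Icc 0 1) := by
  intro t ht
  have hl : ContinuousWithinAt γ.toFun (Icc 0 t) t := by
    rcases ht.1.eq_or_lt with h | h
    · rw [← h, Icc_self]; exact continuousWithinAt_singleton
    · obtain ⟨k, hk⟩ := γ.exists_piece_left ⟨h, ht.2⟩
      exact (γ.hasDerivWithinAt_left hk).continuousWithinAt.mono fun s hs => hs.2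
  have hr : ContinuousWithinAt γ.toFun (Icc t 1) t := by
    rcases ht.2.eq_or_lt with h | h
    · rw [h, Icc_self]; exact continuousWithinAt_singleton
    · obtain ⟨k, hk⟩ := γ.exists_piece_right ⟨ht.1, h⟩
      exact (γ.hasDerivWithinAt_right hk).continuousWithinAt.mono fun s hs => hs.1
  rw [← Icc_union_Icc_eq_Icc ht.1 ht.2]
  exact hl.union hr

/-- The mean value inequality needs only right derivatives, so kinks are harmless. The sum of the
bounds for the pieces serves as a common bound. -/
theorem exists_lipschitz :
    ∃ L : ℝ, 0 ≤ L ∧ ∀ s ∈ Icc (0 : ℝ) 1, ∀ t ∈ Icc (0 : ℝ) 1,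
      dist (γ.toFun s) (γ.toFun t) ≤ L * |s - t| := by
  have hbd : ∀ k, ∃ C, ∀ t ∈ Icc (0 : ℝ) 1, ‖deriv (γ.piece k) t‖ ≤ C := fun k =>
    isCompact_Icc.exists_bound_of_continuousOn (γ.continuous_deriv_piece k).continuousOn
  choose C hC using hbd
  have hL : ∀ k, C k ≤ ∑ k, |C k| := fun k =>
    (le_abs_self _).trans
      (Finset.single_le_sum (f := fun k => |C k|) (fun _ _ => abs_nonneg _) (Finset.mem_univ k))
  refine ⟨∑ k, |C k|, Finset.sum_nonneg fun _ _ => abs_nonneg _, ?_⟩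
  have key : ∀ s ∈ Icc (0 : ℝ) 1, ∀ t ∈ Icc (0 : ℝ) 1, s ≤ t →
      dist (γ.toFun s) (γ.toFun t) ≤ (∑ k, |C k|) * |s - t| := by
    intro s hs t ht hst
    have hd : ∀ x ∈ Ico s t, ∃ v, HasDerivWithinAt γ.toFun v (Ici x) x ∧ ‖v‖ ≤ ∑ k, |C k| := by
      intro x hx
      have hx' : x ∈ Ico (0 : ℝ) 1 := ⟨hs.1.trans hx.1, hx.2.trans_le ht.2⟩
      obtain ⟨k, hk⟩ := γ.exists_piece_right hx'
      exact ⟨_, γ.hasDerivWithinAt_right hk, (hC k x ⟨hx'.1, hx'.2.le⟩).trans (hL k)⟩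
    choose! f' hf' using hd
    have := norm_image_sub_le_of_norm_deriv_right_le_segment
      (γ.continuousOn.mono (Icc_subset_Icc hs.1 ht.2)) (fun x hx => (hf' x hx).1)
      (fun x hx => (hf' x hx).2) t ⟨hst, le_rfl⟩
    rw [dist_comm, dist_eq_norm, abs_sub_comm, abs_of_nonneg (sub_nonneg.2 hst)]
    exact this
  intro s hs t ht
  rcases le_total s t with h | h
  · exact key s hs t ht h
  · rw [dist_comm, abs_sub_comm]
    exact key t ht s hs h

/-- To the right of `t₀` the curve proceeds at least at constant speed in every direction that
has a positive product with its right derivative. -/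
theorem exists_speed_right {t₀ : ℝ} (ht₀ : t₀ ∈ Ico (0 : ℝ) 1) {u : Plane}
    (hu : 0 < inner ℝ u (derivWithin γ.toFun (Ici t₀) t₀)) :
    ∃ c > 0, ∃ e > t₀, ∀ s ∈ Icc t₀ e, ∀ t ∈ Icc t₀ e, s ≤ t →
      c * (t - s) ≤ inner ℝ u (γ.toFun t - γ.toFun s) := by
  obtain ⟨k, hk⟩ := γ.exists_piece_right ht₀
  rw [(γ.hasDerivWithinAt_right hk).derivWithin (uniqueDiffWithinAt_Ici t₀)] at hu
  set v := inner ℝ u (deriv (γ.piece k) t₀) with hv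
  have hcont : Continuous fun t => inner ℝ u (deriv (γ.piece k) t) :=
    continuous_const.inner (γ.continuous_deriv_piece k)
  have hev : ∀ᶠ t in 𝓝[≥] t₀, v / 2 < inner ℝ u (deriv (γ.piece k) t) :=
    (hcont.continuousAt.eventually_const_lt (half_lt_self hu)).filter_mono nhdsWithin_le_nhds
  obtain ⟨e, he, hsub⟩ := mem_nhdsGE_iff_exists_Icc_subset.1
    (Filter.inter_mem hev (Icc_mem_nhdsGE hk.2))
  have hsub' : Icc t₀ e ⊆ Icc (γ.knot k.castSucc) (γ.knot k.succ) := fun s hs =>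
    ⟨hk.1.trans hs.1, (hsub hs).2.2⟩
  refine ⟨v / 2, half_pos hu, e, he, fun s hs t ht hst => ?_⟩
  have hder : ∀ x, HasDerivAt (fun t => inner ℝ u (γ.piece k t))
      (inner ℝ u (deriv (γ.piece k) x)) x := fun x => by
    simpa using (hasDerivAt_const x u).inner ℝ (γ.hasDerivAt_piece k x)
  rw [inner_sub_right, γ.eq_piece k t (hsub' ht), γ.eq_piece k s (hsub' hs)]
  refine (convex_Icc t₀ e).mul_sub_le_image_sub_of_le_deriv
    (fun x _ => (hder x).continuousAt.continuousWithinAt)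
    (fun x _ => (hder x).differentiableAt.differentiableWithinAt) (fun x hx => ?_) s hs t ht hst
  rw [(hder x).deriv]
  exact le_of_lt (hsub (interior_subset hx)).1

/-- To the left of `t₀` the curve proceeds at least at constant speed in every direction that
has a positive product with its left derivative. -/
theorem exists_speed_left {t₀ : ℝ} (ht₀ : t₀ ∈ Ioc (0 : ℝ) 1) {u : Plane}
    (hu : 0 < inner ℝ u (derivWithin γ.toFun (Iic t₀) t₀)) :
    ∃ c > 0, ∃ e < t₀, ∀ s ∈ Icc e t₀, ∀ t ∈ Icc e t₀, s ≤ t →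
      c * (t - s) ≤ inner ℝ u (γ.toFun t - γ.toFun s) := by
  obtain ⟨k, hk⟩ := γ.exists_piece_left ht₀
  rw [(γ.hasDerivWithinAt_left hk).derivWithin (uniqueDiffWithinAt_Iic t₀)] at hu
  set v := inner ℝ u (deriv (γ.piece k) t₀) with hv
  have hcont : Continuous fun t => inner ℝ u (deriv (γ.piece k) t) :=
    continuous_const.inner (γ.continuous_deriv_piece k)
  have hev : ∀ᶠ t in 𝓝[≤] t₀, v / 2 < inner ℝ u (deriv (γ.piece k) t) :=
    (hcont.continuousAt.eventually_const_lt (half_lt_self hu)).filter_mono nhdsWithin_le_nhds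
  obtain ⟨e, he, hsub⟩ := mem_nhdsLE_iff_exists_Icc_subset.1
    (Filter.inter_mem hev (Icc_mem_nhdsLE hk.1))
  have hsub' : Icc e t₀ ⊆ Icc (γ.knot k.castSucc) (γ.knot k.succ) := fun s hs =>
    ⟨(hsub hs).2.1, hs.2.trans hk.2⟩
  refine ⟨v / 2, half_pos hu, e, he, fun s hs t ht hst => ?_⟩
  have hder : ∀ x, HasDerivAt (fun t => inner ℝ u (γ.piece k t))
      (inner ℝ u (deriv (γ.piece k) x)) x := fun x => by
    simpa using (hasDerivAt_const x u).inner ℝ (γ.hasDerivAt_piece k x)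
  rw [inner_sub_right, γ.eq_piece k t (hsub' ht), γ.eq_piece k s (hsub' hs)]
  refine (convex_Icc e t₀).mul_sub_le_image_sub_of_le_deriv
    (fun x _ => (hder x).continuousAt.continuousWithinAt)
    (fun x _ => (hder x).differentiableAt.differentiableWithinAt) (fun x hx => ?_) s hs t ht hst
  rw [(hder x).deriv]
  exact le_of_lt (hsub (interior_subset hx)).1

theorem derivWithin_right_ne_zero {t : ℝ} (ht : t ∈ Ico (0 : ℝ) 1) :
    derivWithin γ.toFun (Ici t) t ≠ 0 := by
  obtain ⟨k, hk⟩ := γ.exists_piece_right ht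
  rw [(γ.hasDerivWithinAt_right hk).derivWithin (uniqueDiffWithinAt_Ici t)]
  exact γ.piece_regular k t ⟨hk.1, hk.2.le⟩

theorem derivWithin_left_ne_zero {t : ℝ} (ht : t ∈ Ioc (0 : ℝ) 1) :
    derivWithin γ.toFun (Iic t) t ≠ 0 := by
  obtain ⟨k, hk⟩ := γ.exists_piece_left ht
  rw [(γ.hasDerivWithinAt_left hk).derivWithin (uniqueDiffWithinAt_Iic t)]
  exact γ.piece_regular k t ⟨hk.1.le, hk.2⟩

end JordanCurve

/-- Two vectors that are not opposite lie in a common open half-plane. -/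
theorem exists_inner_pos_of_not_sameRay_neg {V : Type*} [NormedAddCommGroup V]
    [InnerProductSpace ℝ V] {v w : V} (hv : v ≠ 0) (hw : w ≠ 0) (h : ¬ SameRay ℝ v (-w)) :
    ∃ u : V, 0 < inner ℝ u v ∧ 0 < inner ℝ u w := by
  have hlt : -(‖v‖ * ‖w‖) < inner ℝ v w := by
    have h1 := real_inner_le_norm v (-w)
    have h2 : inner ℝ v (-w) ≠ ‖v‖ * ‖-w‖ := fun h2 =>
      h ((sameRay_iff_norm_smul_eq).2 ((inner_eq_norm_mul_iff_real).1 h2).symm)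
    rw [inner_neg_right, norm_neg] at h1 h2
    have := lt_of_le_of_ne h1 h2
    linarith
  have hv' := norm_pos_iff.2 hv
  have hw' := norm_pos_iff.2 hw
  -- This is the direction of the angle bisector. Both products are positive by the strict
  -- Cauchy–Schwarz inequality above.
  refine ⟨‖w‖ • v + ‖v‖ • w, ?_, ?_⟩
  · rw [inner_add_left, real_inner_smul_left, real_inner_smul_left, real_inner_self_eq_norm_sq,
      real_inner_comm]
    nlinarith
  · rw [inner_add_left, real_inner_smul_left, real_inner_smul_left, real_inner_self_eq_norm_sq]
    nlinarith

/-! ### The chord-arc inequality for curves without cusps -/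

namespace JordanCurve

variable {γ : JordanCurve}

/-- The distance of two parameters on the circle. -/
def paramDist (s t : ℝ) : ℝ := min |s - t| (1 - |s - t|)

theorem paramDist_comm (s t : ℝ) : paramDist s t = paramDist t s := by
  rw [paramDist, paramDist, abs_sub_comm]

/-- The pairs of parameters for which the chord is at least `c` times the arc. -/
def ChordArc (γ : JordanCurve) (c : ℝ) (q : ℝ × ℝ) : Prop :=
  c * paramDist q.1 q.2 ≤ dist (γ.toFun q.1) (γ.toFun q.2)

theorem ChordArc.swap {c s t : ℝ} (h : γ.ChordArc c (s, t)) : γ.ChordArc c (t, s) := by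
  rw [ChordArc, paramDist_comm, dist_comm]; exact h

theorem chordArc_of_inner {c s t : ℝ} {u : Plane} (hu : u ≠ 0)
    (h : c * paramDist s t ≤ inner ℝ u (γ.toFun t - γ.toFun s)) :
    γ.ChordArc (c / ‖u‖) (s, t) := by
  have h1 := real_inner_le_norm u (γ.toFun t - γ.toFun s)
  rw [ChordArc, dist_comm, dist_eq_norm, div_mul_eq_mul_div, div_le_iff₀ (norm_pos_iff.2 hu),
    mul_comm _ ‖u‖]
  exact h.trans h1

theorem ChordArc.mono {c c' s t : ℝ} (h : γ.ChordArc c (s, t)) (hc : c' ≤ c)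
    (hs : s ∈ Icc (0 : ℝ) 1) (ht : t ∈ Icc (0 : ℝ) 1) : γ.ChordArc c' (s, t) := by
  refine le_trans (mul_le_mul_of_nonneg_right hc (le_min (abs_nonneg _) ?_)) h
  have : |s - t| ≤ 1 := abs_le.2 ⟨by linarith [hs.1, ht.2], by linarith [hs.2, ht.1]⟩
  linarith

/-- Absence of a cusp gives a direction in which the curve advances at positive speed on both sides
of `t₀`, so there is no turning back. At the parameters 0 and 1 only one side exists, and the
one-sided derivative itself serves as the direction. -/
theorem chordArc_near_diagonal (hγ : γ.NoCusp) {t₀ : ℝ} (ht₀ : t₀ ∈ Icc (0 : ℝ) 1) :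
    ∃ c > 0, ∃ U ∈ 𝓝[Icc 0 1] t₀, ∀ s ∈ U, ∀ t ∈ U, γ.ChordArc c (s, t) := by
  suffices H : ∃ u : Plane, u ≠ 0 ∧ ∃ c > 0, ∃ U ∈ 𝓝[Icc 0 1] t₀, ∀ s ∈ U, ∀ t ∈ U, s ≤ t →
      c * (t - s) ≤ inner ℝ u (γ.toFun t - γ.toFun s) by
    obtain ⟨u, hu, c, hc, U, hU, h⟩ := H
    have key : ∀ s ∈ U, ∀ t ∈ U, s ≤ t → γ.ChordArc (c / ‖u‖) (s, t) := fun s hs t ht hst =>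
      chordArc_of_inner hu (le_trans (mul_le_mul_of_nonneg_left ((min_le_left _ _).trans_eq (by
        rw [abs_sub_comm, abs_of_nonneg (sub_nonneg.2 hst)])) hc.le) (h s hs t ht hst))
    refine ⟨c / ‖u‖, div_pos hc (norm_pos_iff.2 hu), U, hU, fun s hs t ht => ?_⟩
    rcases le_total s t with hst | hst
    · exact key s hs t ht hst
    · exact (key t ht s hs hst).swap
  rcases ht₀.1.eq_or_lt with h0 | h0
  · have ht : t₀ ∈ Ico (0 : ℝ) 1 := ⟨ht₀.1, h0 ▸ one_pos⟩
    have hw := γ.derivWithin_right_ne_zero ht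
    obtain ⟨c, hc, e, he, h⟩ := γ.exists_speed_right ht (real_inner_self_pos.2 hw)
    refine ⟨_, hw, c, hc, Icc t₀ e, ?_, h⟩
    exact mem_of_superset (inter_mem_nhdsWithin _ (Iic_mem_nhds he)) fun s hs =>
      ⟨h0 ▸ hs.1.1, hs.2⟩
  rcases ht₀.2.eq_or_lt with h1 | h1
  · have ht : t₀ ∈ Ioc (0 : ℝ) 1 := ⟨h0, ht₀.2⟩
    have hw := γ.derivWithin_left_ne_zero ht
    obtain ⟨c, hc, e, he, h⟩ := γ.exists_speed_left ht (real_inner_self_pos.2 hw)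
    refine ⟨_, hw, c, hc, Icc e t₀, ?_, h⟩
    exact mem_of_superset (inter_mem_nhdsWithin _ (Ici_mem_nhds he)) fun s hs =>
      ⟨hs.2, h1 ▸ hs.1.2⟩
  obtain ⟨u, hu1, hu2⟩ := exists_inner_pos_of_not_sameRay_neg
    (γ.derivWithin_left_ne_zero ⟨h0, h1.le⟩) (γ.derivWithin_right_ne_zero ⟨h0.le, h1⟩)
    (hγ.1 t₀ ⟨h0, h1⟩)
  obtain ⟨c₁, hc₁, e₁, he₁, H₁⟩ := γ.exists_speed_left ⟨h0, h1.le⟩ hu1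
  obtain ⟨c₂, hc₂, e₂, he₂, H₂⟩ := γ.exists_speed_right ⟨h0.le, h1⟩ hu2
  refine ⟨u, ?_, min c₁ c₂, lt_min hc₁ hc₂, Icc e₁ e₂,
    mem_nhdsWithin_of_mem_nhds (Icc_mem_nhds he₁ he₂), fun s hs t ht hst => ?_⟩
  · rintro rfl
    simp at hu1
  -- Truncation by `min` and `max` with `t₀` splits the increment from `s` to `t` into its parts
  -- left and right of `t₀`, without distinguishing the positions of `s` and `t`.
  have m1 : min c₁ c₂ * (min t t₀ - min s t₀) ≤
      inner ℝ u (γ.toFun (min t t₀) - γ.toFun (min s t₀)) := by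
    have h := H₁ (min s t₀) ⟨le_min hs.1 he₁.le, min_le_right _ _⟩ (min t t₀)
      ⟨le_min ht.1 he₁.le, min_le_right _ _⟩ (min_le_min_right _ hst)
    exact le_trans (mul_le_mul_of_nonneg_right (min_le_left _ _)
      (sub_nonneg.2 (min_le_min_right _ hst))) h
  have m2 : min c₁ c₂ * (max t t₀ - max s t₀) ≤
      inner ℝ u (γ.toFun (max t t₀) - γ.toFun (max s t₀)) := by
    have h := H₂ (max s t₀) ⟨le_max_right _ _, max_le hs.2 he₂.le⟩ (max t t₀)
      ⟨le_max_right _ _, max_le ht.2 he₂.le⟩ (max_le_max_right _ hst)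
    exact le_trans (mul_le_mul_of_nonneg_right (min_le_right _ _)
      (sub_nonneg.2 (max_le_max_right _ hst))) h
  have e : ∀ x, γ.toFun (min x t₀) + γ.toFun (max x t₀) = γ.toFun x + γ.toFun t₀ := fun x => by
    rcases le_total x t₀ with h | h
    · rw [min_eq_left h, max_eq_right h]
    · rw [min_eq_right h, max_eq_left h, add_comm]
  have e' : γ.toFun t - γ.toFun s = (γ.toFun (min t t₀) - γ.toFun (min s t₀)) +
      (γ.toFun (max t t₀) - γ.toFun (max s t₀)) := by
    rw [sub_add_sub_comm, e, e, add_sub_add_right_eq_sub]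
  rw [e', inner_add_right]
  have e'' : t - s = (min t t₀ - min s t₀) + (max t t₀ - max s t₀) := by
    linarith [min_add_max t t₀, min_add_max s t₀]
  rw [e'', mul_add]
  exact add_le_add m1 m2

/-- The short arc from `t` near 1 to `s` near 0 passes through the closing point. The advances
before and after it add up, by the cusp condition there. -/
theorem chordArc_near_ends (hγ : γ.NoCusp) :
    ∃ c > 0, ∃ U ∈ 𝓝[Icc 0 1] (0 : ℝ), ∃ V ∈ 𝓝[Icc 0 1] (1 : ℝ),
      ∀ s ∈ U, ∀ t ∈ V, γ.ChordArc c (s, t) := by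
  obtain ⟨u, hu1, hu2⟩ := exists_inner_pos_of_not_sameRay_neg
    (γ.derivWithin_left_ne_zero ⟨one_pos, le_rfl⟩) (γ.derivWithin_right_ne_zero ⟨le_rfl, one_pos⟩)
    hγ.2
  obtain ⟨c₁, hc₁, e₁, he₁, H₁⟩ := γ.exists_speed_left ⟨one_pos, le_rfl⟩ hu1
  obtain ⟨c₂, hc₂, e₂, he₂, H₂⟩ := γ.exists_speed_right ⟨le_rfl, one_pos⟩ hu2
  have hu : u ≠ 0 := by
    rintro rfl
    simp at hu1
  have hc := lt_min hc₁ hc₂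
  refine ⟨min c₁ c₂ / ‖u‖, div_pos hc (norm_pos_iff.2 hu), Icc 0 (min e₂ 1), ?_, Icc (max e₁ 0) 1,
    ?_, fun s hs t ht => ?_⟩
  · exact mem_of_superset (inter_mem_nhdsWithin _ (Iic_mem_nhds (lt_min he₂ one_pos)))
      fun s hs => ⟨hs.1.1, hs.2⟩
  · exact mem_of_superset (inter_mem_nhdsWithin _ (Ici_mem_nhds (max_lt he₁ one_pos)))
      fun s hs => ⟨hs.2, hs.1.2⟩
  obtain ⟨hs0, hs1⟩ := hs
  obtain ⟨ht0, ht1⟩ := ht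
  rw [le_min_iff] at hs1
  rw [max_le_iff] at ht0
  have h1 := H₁ t ⟨ht0.1, ht1⟩ 1 ⟨he₁.le, le_rfl⟩ ht1
  have h2 := H₂ 0 ⟨le_rfl, he₂.le⟩ s ⟨hs0, hs1.1⟩ hs0
  refine (chordArc_of_inner hu ?_).swap
  rw [show γ.toFun s - γ.toFun t = (γ.toFun 1 - γ.toFun t) + (γ.toFun s - γ.toFun 0) by
    rw [γ.closed]; abel, inner_add_right]
  have h3 : paramDist t s ≤ (1 - t) + (s - 0) :=
    (min_le_right _ _).trans (by linarith [le_abs_self (t - s)])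
  have h4 : min c₁ c₂ * (1 - t) ≤ c₁ * (1 - t) :=
    mul_le_mul_of_nonneg_right (min_le_left _ _) (by linarith)
  have h5 : min c₁ c₂ * (s - 0) ≤ c₂ * (s - 0) :=
    mul_le_mul_of_nonneg_right (min_le_right _ _) (by linarith)
  nlinarith [mul_le_mul_of_nonneg_left h3 hc.le]

/-- On a Jordan curve without cusps, the chord is at least a constant times the arc. -/
theorem exists_chordArc (hγ : γ.NoCusp) :
    ∃ c > 0, ∀ s ∈ Icc (0 : ℝ) 1, ∀ t ∈ Icc (0 : ℝ) 1, γ.ChordArc c (s, t) := by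
  set I : Set ℝ := Icc 0 1 with hI
  suffices H : ∃ c > 0, ∀ q ∈ I ×ˢ I, q ∈ I ×ˢ I → γ.ChordArc c q by
    obtain ⟨c, hc, H⟩ := H
    exact ⟨c, hc, fun s hs t ht => H (s, t) ⟨hs, ht⟩ ⟨hs, ht⟩⟩
  have hcomp : IsCompact (I ×ˢ I) := isCompact_Icc.prod isCompact_Icc
  -- By compactness a local constant suffices. Pairs with distinct images are handled by continuity,
  -- and by injectivity the others lie on the diagonal or are the two ends.
  refine hcomp.induction_on (p := fun S => ∃ c > 0, ∀ q ∈ S, q ∈ I ×ˢ I → γ.ChordArc c q)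
    ⟨1, one_pos, fun q hq => hq.elim⟩ ?_ ?_ ?_
  · rintro S T hST ⟨c, hc, h⟩
    exact ⟨c, hc, fun q hq => h q (hST hq)⟩
  · rintro S T ⟨c₁, hc₁, h₁⟩ ⟨c₂, hc₂, h₂⟩
    refine ⟨min c₁ c₂, lt_min hc₁ hc₂, fun q hq hqI => ?_⟩
    rcases hq with hq | hq
    · exact (h₁ q hq hqI).mono (min_le_left _ _) hqI.1 hqI.2
    · exact (h₂ q hq hqI).mono (min_le_right _ _) hqI.1 hqI.2
  · rintro ⟨s₀, t₀⟩ ⟨hs₀, ht₀⟩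
    simp only at hs₀ ht₀
    by_cases heq : γ.toFun s₀ = γ.toFun t₀
    · have hcases : s₀ = t₀ ∨ (s₀ = 0 ∧ t₀ = 1) ∨ (s₀ = 1 ∧ t₀ = 0) := by
        rcases hs₀.2.eq_or_lt with h1 | h1 <;> rcases ht₀.2.eq_or_lt with h2 | h2
        · exact Or.inl (h1.trans h2.symm)
        · rw [h1, ← γ.closed] at heq
          exact Or.inr (Or.inr ⟨h1, (γ.injOn ⟨le_rfl, one_pos⟩ ⟨ht₀.1, h2⟩ heq).symm⟩)
        · rw [h2, ← γ.closed] at heq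
          exact Or.inr (Or.inl ⟨γ.injOn ⟨hs₀.1, h1⟩ ⟨le_rfl, one_pos⟩ heq, h2⟩)
        · exact Or.inl (γ.injOn ⟨hs₀.1, h1⟩ ⟨ht₀.1, h2⟩ heq)
      rcases hcases with rfl | ⟨rfl, rfl⟩ | ⟨rfl, rfl⟩
      · obtain ⟨c, hc, U, hU, h⟩ := chordArc_near_diagonal hγ hs₀
        exact ⟨U ×ˢ U, by rw [nhdsWithin_prod_eq]; exact prod_mem_prod hU hU, c, hc,
          fun q hq _ => h q.1 hq.1 q.2 hq.2⟩
      · obtain ⟨c, hc, U, hU, V, hV, h⟩ := chordArc_near_ends hγ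
        exact ⟨U ×ˢ V, by rw [nhdsWithin_prod_eq]; exact prod_mem_prod hU hV, c, hc,
          fun q hq _ => h q.1 hq.1 q.2 hq.2⟩
      · obtain ⟨c, hc, U, hU, V, hV, h⟩ := chordArc_near_ends hγ
        exact ⟨V ×ˢ U, by rw [nhdsWithin_prod_eq]; exact prod_mem_prod hV hU, c, hc,
          fun q hq _ => (h q.2 hq.2 q.1 hq.1).swap⟩
    · have hd : 0 < dist (γ.toFun s₀) (γ.toFun t₀) := dist_pos.2 heq
      have hc : ContinuousWithinAt (fun q : ℝ × ℝ => dist (γ.toFun q.1) (γ.toFun q.2)) (I ×ˢ I)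
          (s₀, t₀) := by
        have h1 : ContinuousWithinAt (fun q : ℝ × ℝ => γ.toFun q.1) (I ×ˢ I) (s₀, t₀) :=
          (γ.continuousOn s₀ hs₀).comp continuous_fst.continuousWithinAt fun q hq => hq.1
        have h2 : ContinuousWithinAt (fun q : ℝ × ℝ => γ.toFun q.2) (I ×ˢ I) (s₀, t₀) :=
          (γ.continuousOn t₀ ht₀).comp continuous_snd.continuousWithinAt fun q hq => hq.2
        exact h1.dist h2
      refine ⟨_, hc.eventually_const_lt (half_lt_self hd), _, half_pos hd, fun q hq hqI => ?_⟩
      have hq' : dist (γ.toFun s₀) (γ.toFun t₀) / 2 < dist (γ.toFun q.1) (γ.toFun q.2) := hq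
      have h1 : |q.1 - q.2| ≤ 1 := abs_le.2
        ⟨by linarith [hqI.1.1, hqI.2.2], by linarith [hqI.1.2, hqI.2.1]⟩
      have h2 : paramDist q.1 q.2 ≤ 1 := (min_le_left _ _).trans h1
      exact le_trans (mul_le_of_le_one_right (half_pos hd).le h2) hq'.le

theorem isCompact_trace (γ : JordanCurve) : IsCompact γ.trace :=
  isCompact_Icc.image_of_continuousOn γ.continuousOn

end JordanCurve

/-! ## Counting cells -/

/-- A bound for the number of cells whose centers are within distance `ρ h` of a point. -/
noncomputable def cellBound (ρ : ℝ) : ℕ := (2 * (⌈ρ⌉₊ + 1) + 1) ^ 2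

/-- The extra 1 in the box radius absorbs the half-cell offset of the centers and the rounding of `y
/ h`. -/
theorem exists_finset_near {h : ℝ} (hh : 0 < h) (y : Plane) (ρ : ℝ) :
    ∃ F : Finset Idx, F.card ≤ cellBound ρ ∧ ∀ i, dist (cellCenter h i) y ≤ ρ * h → i ∈ F := by
  set m : Idx := fun d => ⌊y d / h⌋ with hm
  set M : ℤ := ⌈ρ⌉₊ + 1 with hM
  refine ⟨Finset.Icc (fun d => m d - M) (fun d => m d + M), ?_, fun i hi => ?_⟩
  · rw [Pi.card_Icc, Fin.prod_univ_two]
    simp only [Int.card_Icc, cellBound]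
    rw [show (m 0 + M + 1 - (m 0 - M)).toNat = 2 * (⌈ρ⌉₊ + 1) + 1 by omega,
      show (m 1 + M + 1 - (m 1 - M)).toNat = 2 * (⌈ρ⌉₊ + 1) + 1 by omega, sq]
  · have key : ∀ d, m d - M ≤ i d ∧ i d ≤ m d + M := by
      intro d
      have h1 := (Plane.abs_sub_le_dist _ _ d).trans hi
      have e : cellCenter h i d - y d = ((i d : ℝ) + 1 / 2 - y d / h) * h := by
        simp only [cellCenter]; field_simp
      rw [e, abs_mul, abs_of_pos hh, mul_le_mul_iff_left₀ hh, abs_le] at h1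
      have h2 : (m d : ℝ) ≤ y d / h := Int.floor_le _
      have h3 : y d / h < m d + 1 := Int.lt_floor_add_one _
      have h4 : ρ ≤ ⌈ρ⌉₊ := Nat.le_ceil ρ
      constructor
      · have : ((m d - M : ℤ) : ℝ) ≤ (i d : ℝ) := by rw [hM]; push_cast; linarith
        exact_mod_cast this
      · have : (i d : ℝ) ≤ ((m d + M : ℤ) : ℝ) := by rw [hM]; push_cast; linarith
        exact_mod_cast this
    exact Finset.mem_Icc.2 ⟨fun d => (key d).1, fun d => (key d).2⟩

theorem dist_cellCenter_le {h : ℝ} (hh : 0 < h) {i j : Idx} {n : ℝ}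
    (hij : ∀ d, |(i d : ℝ) - j d| ≤ n) : dist (cellCenter h i) (cellCenter h j) ≤ 2 * n * h := by
  have key : ∀ d, |cellCenter h i d - cellCenter h j d| ≤ n * h := fun d => by
    have e : cellCenter h i d - cellCenter h j d = ((i d : ℝ) - j d) * h := by
      simp only [cellCenter]; ring
    rw [e, abs_mul, abs_of_pos hh]
    exact mul_le_mul_of_nonneg_right (hij d) hh.le
  refine (Plane.dist_le_sum _ _).trans ?_
  linarith [key 0, key 1]

/-- The number of cells near finitely many Jordan curves is at most inversely proportional to the
grid size. -/
theorem exists_card_near_curves_le {r : ℕ} (γ : Fin r → JordanCurve) (ρ : ℝ) :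
    ∃ C : ℝ, 0 ≤ C ∧ ∀ h : ℝ, 0 < h → h ≤ 1 → ∃ F : Finset Idx, (F.card : ℝ) ≤ C / h ∧
      ∀ i, (∃ x ∈ ⋃ c, (γ c).trace, dist (cellCenter h i) x ≤ ρ * h) → i ∈ F := by
  choose L hL0 hL using fun c => (γ c).exists_lipschitz
  refine ⟨2 * ((∑ c, cellBound (ρ + L c) : ℕ) : ℝ), by positivity, fun h hh hh1 => ?_⟩
  -- The curves are sampled at the parameters `k * h`. Every curve point is within `L c * h` of a
  -- sample, so the radius `ρ + L c` suffices, and `h ≤ 1` bounds the number of samples per curve by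
  -- `2 / h`.
  choose F hFc hF using fun (c : Fin r) (k : ℕ) =>
    exists_finset_near hh ((γ c).toFun (k * h)) (ρ + L c)
  refine ⟨Finset.univ.biUnion fun c => (Finset.range (⌊1 / h⌋₊ + 1)).biUnion fun k => F c k,
    ?_, ?_⟩
  · have h1 : (Finset.univ.biUnion fun c =>
        (Finset.range (⌊1 / h⌋₊ + 1)).biUnion fun k => F c k).card ≤
        ∑ c, (⌊1 / h⌋₊ + 1) * cellBound (ρ + L c) := by
      refine Finset.card_biUnion_le.trans (Finset.sum_le_sum fun c _ => ?_)
      refine (Finset.card_biUnion_le_card_mul _ _ _ fun k _ => hFc c k).trans ?_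
      rw [Finset.card_range]
    rw [← Finset.mul_sum] at h1
    have h2 : ((⌊1 / h⌋₊ + 1 : ℕ) : ℝ) ≤ 2 / h := by
      have h3 : (⌊1 / h⌋₊ : ℝ) ≤ 1 / h := Nat.floor_le (by positivity)
      have h4 : 1 ≤ 1 / h := by rw [le_div_iff₀ hh]; linarith
      push_cast
      rw [show 2 / h = 1 / h + 1 / h by ring]
      linarith
    refine (Nat.cast_le.2 h1).trans ?_
    rw [Nat.cast_mul, mul_div_right_comm]
    exact mul_le_mul_of_nonneg_right h2 (Nat.cast_nonneg _)
  · rintro i ⟨x, hx, hix⟩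
    obtain ⟨c, t, ht, rfl⟩ := mem_iUnion.1 hx
    simp only [Finset.mem_biUnion, Finset.mem_univ, true_and, Finset.mem_range]
    have h0 : 0 ≤ t / h := div_nonneg ht.1 hh.le
    refine ⟨c, ⌊t / h⌋₊, Nat.lt_succ_of_le (Nat.floor_le_floor ?_), hF c _ i ?_⟩
    · exact div_le_div_of_nonneg_right ht.2 hh.le
    have h1 : (⌊t / h⌋₊ : ℝ) * h ≤ t := (le_div_iff₀ hh).1 (Nat.floor_le h0)
    have h2 : t < (⌊t / h⌋₊ + 1 : ℝ) * h := (div_lt_iff₀ hh).1 (Nat.lt_floor_add_one _)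
    have h3 := hL c t ht (⌊t / h⌋₊ * h) ⟨by positivity, h1.trans ht.2⟩
    have h4 : |t - ⌊t / h⌋₊ * h| ≤ h := abs_le.2 ⟨by linarith, by linarith⟩
    have h5 := mul_le_mul_of_nonneg_left h4 (hL0 c)
    rw [add_mul]
    exact (dist_triangle _ _ _).trans (add_le_add hix (h3.trans h5))

/-- Disjoint compact sets have positive distance. Phrasing this for all small `δ` lets finitely many
pairs share one value. -/
theorem exists_separation {r : ℕ} {γ : Fin r → JordanCurve}
    (hγ : ∀ c c', c ≠ c' → Disjoint (γ c).trace (γ c').trace) :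
    ∃ δ > 0, ∀ c c', c ≠ c' → ∀ x ∈ (γ c).trace, ∀ y ∈ (γ c').trace, δ < dist x y := by
  have H : ∀ᶠ δ : ℝ in 𝓝[>] 0, ∀ c c', c ≠ c' →
      ∀ x ∈ (γ c).trace, ∀ y ∈ (γ c').trace, δ < dist x y := by
    refine eventually_all.2 fun c => eventually_all.2 fun c' => ?_
    by_cases hc : c = c'
    · exact Eventually.of_forall fun δ h => absurd hc h
    obtain ⟨ρ, hρ, h⟩ := Metric.exists_pos_forall_lt_edist (γ c).isCompact_trace
      (γ c').isCompact_trace.isClosed (hγ c c' hc)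
    filter_upwards [Ioc_mem_nhdsGT (NNReal.coe_pos.2 hρ)] with δ hδ _ x hx y hy
    have h1 := h x hx y hy
    rw [edist_nndist, ENNReal.coe_lt_coe] at h1
    exact hδ.2.trans_lt (by exact_mod_cast h1)
  obtain ⟨δ, h1, h2⟩ := (H.and self_mem_nhdsWithin).exists
  exact ⟨δ, h2, h1⟩

/-! ## The structure of the block of the PLG cells -/

namespace PLGOrdering

variable {r : ℕ} {Ω : Set Plane} {γ : Fin r → JordanCurve} {E : EllipticProblem}
  {h : ℝ} {𝒞 : Idx → Set Plane}

theorem sum_size (o : PLGOrdering Ω γ E h 𝒞) : ∑ c, o.size c = (plgCells Ω E h 𝒞).ncard := by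
  rw [← o.range_cell, ← image_univ, ncard_image_of_injective _ o.cell_injective, ncard_univ,
    Nat.card_eq_fintype_card, Fintype.card_sigma]
  simp

theorem card_le_cellBound (o : PLGOrdering Ω γ E h 𝒞) (hh : 0 < h) {c : Fin r}
    (S : Finset (Fin (o.size c))) (y : Plane) (ρ : ℝ)
    (hS : ∀ k ∈ S, dist (cellCenter h (o.cell ⟨c, k⟩)) y ≤ ρ * h) : S.card ≤ cellBound ρ := by
  obtain ⟨F, hFc, hF⟩ := exists_finset_near hh y ρ
  refine (Finset.card_le_card_of_injOn (fun k => o.cell ⟨c, k⟩) (fun k hk => hF _ (hS k hk))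
    fun k _ l _ hkl => ?_).trans hFc
  simpa using o.cell_injective hkl

theorem abs_sub_le_of_A22_ne_zero (o : PLGOrdering Ω γ E h 𝒞) {R : ℕ} {T : Idx → Finset Idx}
    (hT : ∀ i ∈ plgCells Ω E h 𝒞, IsPLGStencil R 𝒞 i (T i)) {x y : Σ c, Fin (o.size c)}
    (hxy : o.A22 T x y ≠ 0) (d : Fin 2) : |(o.cell x d : ℝ) - o.cell y d| ≤ R := by
  have hmem : o.cell y ∈ T (o.cell x) := by
    by_contra hmem
    exact hxy (dif_neg hmem)
  obtain ⟨⟨b, hb1, hb2⟩, -⟩ := hT (o.cell x) (o.range_cell ▸ mem_range_self x)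
  have h1 := hb1 d
  have h2 := hb2 _ hmem d
  have : |o.cell x d - o.cell y d| ≤ (R : ℤ) := abs_le.2 ⟨by omega, by omega⟩
  exact_mod_cast this

theorem dist_closest_le (o : PLGOrdering Ω γ E h 𝒞) (hΩ : IsDomainWithBoundary Ω γ) {ε : ℝ}
    (hh : 0 < h) (hε : ε < 1) (h𝒞 : IsMergedCutCells Ω h ε 𝒞) (c : Fin r)
    (k : Fin (o.size c)) :
    dist (cellCenter h (o.cell ⟨c, k⟩)) ((γ c).toFun (o.param c k)) ≤ 7 * h := by
  obtain ⟨x, hx, hd⟩ := exists_frontier_near_plgCell hΩ.regularOpen hΩ.bounded hh hε h𝒞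
    (o.range_cell ▸ mem_range_self (⟨c, k⟩ : Σ c, Fin (o.size c)))
  exact (o.closest c k x hx).trans hd

/-- Each closest point is within `7 * h` of its center, and the centers differ by at most `R * h` in
each coordinate. -/
theorem dist_closest_le_of_A22_ne_zero (o : PLGOrdering Ω γ E h 𝒞)
    (hΩ : IsDomainWithBoundary Ω γ) {ε : ℝ} (hh : 0 < h) (hε : ε < 1)
    (h𝒞 : IsMergedCutCells Ω h ε 𝒞) {R : ℕ} {T : Idx → Finset Idx}
    (hT : ∀ i ∈ plgCells Ω E h 𝒞, IsPLGStencil R 𝒞 i (T i)) {c c' : Fin r}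
    {k : Fin (o.size c)} {l : Fin (o.size c')} (hkl : o.A22 T ⟨c, k⟩ ⟨c', l⟩ ≠ 0) :
    dist ((γ c).toFun (o.param c k)) ((γ c').toFun (o.param c' l)) ≤ (14 + 2 * R) * h := by
  have h1 := o.dist_closest_le hΩ hh hε h𝒞 c k
  have h2 := o.dist_closest_le hΩ hh hε h𝒞 c' l
  have h3 := dist_cellCenter_le hh (o.abs_sub_le_of_A22_ne_zero hT hkl)
  rw [dist_comm] at h1
  refine (dist_triangle4 _ (cellCenter h (o.cell ⟨c, k⟩)) (cellCenter h (o.cell ⟨c', l⟩)) _).trans ?_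
  linarith

/-- Coupled cells have closest points with parameters within `Δ * h` on the circle. The cells
numbered along this short arc are confined to a ball of radius `O(h)`, so their number, and with it
the index gap, is bounded. -/
theorem isBandedUpToCorners_A22Block (o : PLGOrdering Ω γ E h 𝒞)
    (hΩ : IsDomainWithBoundary Ω γ) {ε : ℝ} (hh : 0 < h) (hε : ε < 1)
    (h𝒞 : IsMergedCutCells Ω h ε 𝒞) {R : ℕ} {T : Idx → Finset Idx}
    (hT : ∀ i ∈ plgCells Ω E h 𝒞, IsPLGStencil R 𝒞 i (T i)) {c : Fin r} {L a : ℝ} (hL0 : 0 ≤ L)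
    (hL : ∀ s ∈ Icc (0 : ℝ) 1, ∀ t ∈ Icc (0 : ℝ) 1,
      dist ((γ c).toFun s) ((γ c).toFun t) ≤ L * |s - t|)
    (ha : 0 < a) (hγ : ∀ s ∈ Icc (0 : ℝ) 1, ∀ t ∈ Icc (0 : ℝ) 1, (γ c).ChordArc a (s, t)) {p : ℕ}
    (hp : cellBound (7 + L * ((14 + 2 * R) / a)) ≤ p) :
    IsBandedUpToCorners p (o.A22Block T c) := by
  set Δ : ℝ := (14 + 2 * R) / a with hΔ
  have hpar : ∀ k, o.param c k ∈ Icc (0 : ℝ) 1 := fun k => Ico_subset_Icc_self (o.param_mem c k)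
  have hcard : ∀ (S : Finset (Fin (o.size c))) (k : Fin (o.size c)),
      (∀ m ∈ S, |o.param c m - o.param c k| ≤ Δ * h) → S.card ≤ p := by
    intro S k hS
    refine (o.card_le_cellBound hh S ((γ c).toFun (o.param c k)) _ fun m hm => ?_).trans hp
    have h1 := o.dist_closest_le hΩ hh hε h𝒞 c m
    have h2 := hL _ (hpar m) _ (hpar k)
    have h3 := mul_le_mul_of_nonneg_left (hS m hm) hL0
    refine (dist_triangle _ ((γ c).toFun (o.param c m)) _).trans ?_
    linarith
  have hdist : ∀ k l, o.A22Block T c k l ≠ 0 →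
      JordanCurve.paramDist (o.param c k) (o.param c l) ≤ Δ * h := by
    intro k l hkl
    have h1 := o.dist_closest_le_of_A22_ne_zero hΩ hh hε h𝒞 hT hkl
    have h2 := (hγ _ (hpar k) _ (hpar l)).trans h1
    rw [hΔ, div_mul_eq_mul_div, le_div_iff₀ ha, mul_comm]
    exact h2
  have key : ∀ k l, k ≤ l → JordanCurve.paramDist (o.param c k) (o.param c l) ≤ Δ * h →
      (l : ℕ) ≤ k + p ∨ ((k : ℕ) < p ∧ o.size c ≤ l + p) := by
    intro k l hkl hd
    have hst := o.param_monotone c hkl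
    have h0 := (hpar k).1
    have h1 := (hpar l).2
    rw [JordanCurve.paramDist, abs_sub_comm, abs_of_nonneg (sub_nonneg.2 hst), min_le_iff] at hd
    rcases hd with hd | hd
    · left
      have := hcard (Finset.Icc k l) k fun m hm => by
        rw [Finset.mem_Icc] at hm
        have h2 := o.param_monotone c hm.1
        have h3 := o.param_monotone c hm.2
        rw [abs_of_nonneg (sub_nonneg.2 h2)]
        linarith
      rw [Fin.card_Icc] at this
      omega
    -- The short arc wraps around: the parameter of `k` and one minus that of `l` sum to at most `Δ
    -- * h`. Hence everything numbered up to `k` lies near its point, everything from `l` on lies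
    -- near that of `l`, and both counts are at most `p`.
    · right
      have e1 := hcard (Finset.Iic k) k fun m hm => by
        rw [Finset.mem_Iic] at hm
        have h2 := o.param_monotone c hm
        have h3 := (hpar m).1
        rw [abs_sub_comm, abs_of_nonneg (sub_nonneg.2 h2)]
        linarith
      have e2 := hcard (Finset.Ici l) l fun m hm => by
        rw [Finset.mem_Ici] at hm
        have h2 := o.param_monotone c hm
        have h3 := (hpar m).2
        rw [abs_of_nonneg (sub_nonneg.2 h2)]
        linarith
      rw [Fin.card_Iic] at e1
      rw [Fin.card_Ici] at e2
      omega
  intro k l hkl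
  have hd := hdist k l hkl
  rcases le_total k l with hle | hle
  · have h1 : (k : ℕ) ≤ l := hle
    rcases key k l hle hd with h2 | h2
    · exact Or.inl ⟨by omega, h2⟩
    · exact Or.inr (Or.inl h2)
  · rw [JordanCurve.paramDist_comm] at hd
    have h1 : (l : ℕ) ≤ k := hle
    rcases key l k hle hd with h2 | h2
    · exact Or.inl ⟨h2, by omega⟩
    · exact Or.inr (Or.inr h2)

theorem A22_eq_blockDiagonal' (o : PLGOrdering Ω γ E h 𝒞) (T : Idx → Finset Idx)
    (hsep : ∀ (c c' : Fin r) (k : Fin (o.size c)) (l : Fin (o.size c')), c ≠ c' →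
      o.A22 T ⟨c, k⟩ ⟨c', l⟩ = 0) :
    o.A22 T = Matrix.blockDiagonal' (o.A22Block T) := by
  ext ⟨c, k⟩ ⟨c', l⟩
  by_cases hc : c = c'
  · subst hc
    rw [Matrix.blockDiagonal'_apply_eq]
    rfl
  · rw [Matrix.blockDiagonal'_apply_ne _ _ _ hc]
    exact hsep c c' k l hc

end PLGOrdering

/-! ### The cell count and the main theorem -/

theorem exists_ncard_plgCells_le {r : ℕ} {Ω : Set Plane} {γ : Fin r → JordanCurve}
    (hΩ : IsDomainWithBoundary Ω γ) :
    ∃ C : ℝ, 0 ≤ C ∧ ∀ (E : EllipticProblem) (ε h : ℝ), ε < 1 → 0 < h → h ≤ 1 →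
      ∀ 𝒞 : Idx → Set Plane, IsMergedCutCells Ω h ε 𝒞 →
        (plgCells Ω E h 𝒞).Finite ∧ ((plgCells Ω E h 𝒞).ncard : ℝ) ≤ C / h := by
  obtain ⟨C, hC0, hC⟩ := exists_card_near_curves_le γ 7
  refine ⟨C, hC0, fun E ε h hε hh hh1 𝒞 h𝒞 => ?_⟩
  obtain ⟨F, hFc, hF⟩ := hC h hh hh1
  have hsub : plgCells Ω E h 𝒞 ⊆ F := fun i hi =>
    hF i (hΩ.frontier_eq ▸ exists_frontier_near_plgCell hΩ.regularOpen hΩ.bounded hh hε h𝒞 hi)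
  refine ⟨F.finite_toSet.subset hsub, le_trans (Nat.cast_le.2 ?_) hFc⟩
  rw [← ncard_coe_finset F]
  exact ncard_le_ncard hsub F.finite_toSet

theorem mainTheorem1 {r : ℕ} (Ω : Set Plane) (γ : Fin r → JordanCurve)
    (hΩ : IsDomainWithBoundary Ω γ) :
    (∃ C : ℝ, ∀ (E : EllipticProblem) (ε h : ℝ), 0 < ε → ε < 1 → 0 < h → h ≤ 1 →
      ∀ 𝒞 : Idx → Set Plane, IsMergedCutCells Ω h ε 𝒞 →
        (plgCells Ω E h 𝒞).Finite ∧ ((plgCells Ω E h 𝒞).ncard : ℝ) ≤ C / h) ∧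
    ((∀ c, (γ c).NoCusp) → (∀ c c', c ≠ c' → Disjoint (γ c).trace (γ c').trace) →
      ∀ R : ℕ, ∃ (C : ℝ) (p : ℕ) (h₀ : ℝ), 0 < h₀ ∧
        ∀ (E : EllipticProblem) (ε h : ℝ), 0 < ε → ε < 1 → 0 < h → h ≤ h₀ →
        ∀ 𝒞 : Idx → Set Plane, IsMergedCutCells Ω h ε 𝒞 →
        ∀ T : Idx → Finset Idx, (∀ i ∈ plgCells Ω E h 𝒞, IsPLGStencil R 𝒞 i (T i)) →
        ∀ o : PLGOrdering Ω γ E h 𝒞,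
          ((∑ c, o.size c : ℕ) : ℝ) ≤ C / h ∧
          o.A22 T = Matrix.blockDiagonal' (o.A22Block T) ∧
          (∀ c, IsBandedUpToCorners p (o.A22Block T c)) ∧
          ((∑ c, (runLU p (o.A22Block T c)).cost : ℕ) : ℝ) ≤ C / h ∧
          ((∀ c, HasNonzeroPivots (o.A22Block T c)) →
            Matrix.blockDiagonal'
                (fun c => lowerFactor (o.size c) (runLU p (o.A22Block T c)).val) *
              Matrix.blockDiagonal'
                (fun c => upperFactor (o.size c) (runLU p (o.A22Block T c)).val) =
              o.A22 T)) := by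
  obtain ⟨C, hC0, hC⟩ := exists_ncard_plgCells_le hΩ
  refine ⟨⟨C, fun E ε h _ hε hh hh1 => hC E ε h hε hh hh1⟩, fun hcusp hdisj R => ?_⟩
  choose L hL0 hL using fun c => (γ c).exists_lipschitz
  choose a ha hγ using fun c => JordanCurve.exists_chordArc (hcusp c)
  obtain ⟨δ, hδ, hsep⟩ := exists_separation hdisj
  -- The sum dominates the width needed for each single curve.
  set p : ℕ := ∑ c, cellBound (7 + L c * ((14 + 2 * R) / a c)) with hp
  have hK : (0 : ℝ) < 14 + 2 * R := by positivity
  -- The summand 1 makes the same constant bound the size as well. The choice of `h₀` gives `(14 + 2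
  -- * R) * h ≤ δ`, which forbids coupling between different curves.
  refine ⟨C * ((10 * p ^ 2 + 3 * p + 1 : ℕ) : ℝ), p, min 1 (δ / (14 + 2 * R)),
    lt_min one_pos (div_pos hδ hK), fun E ε h _ hε hh hh0 𝒞 h𝒞 T hT o => ?_⟩
  rw [le_min_iff, le_div_iff₀ hK] at hh0
  have hsize : ((∑ c, o.size c : ℕ) : ℝ) ≤ C / h := by
    rw [o.sum_size]
    exact (hC E ε h hε hh hh0.1 𝒞 h𝒞).2
  have hdiag : o.A22 T = Matrix.blockDiagonal' (o.A22Block T) := by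
    refine o.A22_eq_blockDiagonal' T fun c c' k l hc => ?_
    by_contra hne
    have h1 := o.dist_closest_le_of_A22_ne_zero hΩ hh hε h𝒞 hT hne
    have h2 := hsep c c' hc _ (mem_image_of_mem _ (Ico_subset_Icc_self (o.param_mem c k))) _
      (mem_image_of_mem _ (Ico_subset_Icc_self (o.param_mem c' l)))
    linarith
  have hband : ∀ c, IsBandedUpToCorners p (o.A22Block T c) := fun c =>
    o.isBandedUpToCorners_A22Block hΩ hh hε h𝒞 hT (hL0 c) (hL c) (ha c) (hγ c)
      (Finset.single_le_sum (f := fun c => cellBound (7 + L c * ((14 + 2 * R) / a c)))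
        (fun _ _ => Nat.zero_le _) (Finset.mem_univ c))
  have hCh : 0 ≤ C / h := div_nonneg hC0 hh.le
  refine ⟨hsize.trans ?_, hdiag, hband, ?_, fun hpiv => ?_⟩
  · rw [mul_div_right_comm]
    refine le_mul_of_one_le_right hCh ?_
    exact_mod_cast Nat.le_add_left 1 _
  · have h1 : ∑ c, (runLU p (o.A22Block T c)).cost ≤
        (∑ c, o.size c) * (10 * p ^ 2 + 3 * p + 1) := by
      rw [Finset.sum_mul]
      refine Finset.sum_le_sum fun c _ => (runLU_cost_le p _).trans ?_
      rw [mul_comm]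
      exact Nat.mul_le_mul_left _ (Nat.le_succ _)
    refine (Nat.cast_le.2 h1).trans ?_
    rw [Nat.cast_mul, mul_div_right_comm]
    exact mul_le_mul_of_nonneg_right hsize (Nat.cast_nonneg _)
  · rw [← Matrix.blockDiagonal'_mul, hdiag]
    exact congrArg _ (funext fun c => (hband c).lowerFactor_mul_upperFactor (hpiv c))
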